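/- Let $G$ be a discrete group satisfying the following two conditions. (M) Every non-trivial finite subgroup of $G$ is contained in a unique maximal finite subgroup (i.e. a maximal element of the set of finite subgroups of $G$). (NM) If $M$ is a maximal finite subgroup of $G$ and $M \neq \{1\}$, then $N_G M = M$. Here a $G$-CW-complex is a $G$-space $X$ with a filtration $\emptyset = X_{-1} \subseteq X_0 \subseteq X_1 \subseteq \cdots$ by $G$-invariant subspaces such that $\bigcup_n X_n = X$, $X$ carries the colimit topology, and for each $n \ge 0$ the space $X_n$ is a $G$-pushout of $X_{n-1} \leftarrow \coprod_{i\in I_n} G/H_i \times S^{n-1} \hookrightarrow \coprod_{i\in I_n} G/H_i \times D^n$. For a family $\mathcal F$ of subgroups of $G$, a model for $E_{\mathcal F}(G)$ is a $G$-CW-complex all of whose isotropy groups belong to $\mathcal F$ and such that for every $G$-CW-complex $Y$ whose isotropy groups belong to $\mathcal F$ there is, up to $G$-homotopy, precisely one $G$-map from $Y$ to it. Write $EG = E_{\mathcal F}(G)$ for $\mathcal F = \{\{1\}\}$, and $\underline{E}G = E_{\mathcal F}(G)$ for $\mathcal F$ the family of finite subgroups of $G$ (the classifying space for proper $G$-actions).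 Let $(M_i)_{i\in I}$ be a complete system of representatives of the conjugacy classes of maximal finite subgroups of $G$. For each $i\in I$ let $EM_i$ be a model for the classifying space $E(M_i)$ of the group $M_i$, let $EG$ be a model for the classifying space $EG$, and let $$j_1\colon \coprod_{i\in I} G\times_{M_i} EM_i \to EG$$ be an inclusion of $G$-CW-complexes, i.e. a $G$-map which is a homeomorphism onto a $G$-CW-subcomplex of $EG$. Let $$u_1\colon \coprod_{i\in I} G\times_{M_i} EM_i \to \coprod_{i\in I} G/M_i$$ be the $G$-map collapsing each $EM_i$ to a point, and let the $G$-space $X$ be the $G$-pushout of $j_1$ and $u_1$: $$\begin{array}{ccc} \coprod_{i\in I} G\times_{M_i} EM_i & \xrightarrow{\;j_1\;} & EG\\ {\scriptstyle u_1}\downarrow & & \downarrow{\scriptstyle f_1}\\ \coprod_{i\in I} G/M_i & \xrightarrow{\;k_1\;} & X \end{array}$$ Then $X$ is a model for $\underline{E}G$; that is, $X$ is a $G$-CW-complex, all its isotropy groups are finite, and for every $G$-CW-complex $Y$ with finite isotropy groups there is, up to $G$-homotopy, precisely one $G$-map $Y \to X$. -/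

import Mathlib

open Topology

universe u

/-! ### Equivariant maps, pushouts of `G`-spaces -/

/-- A continuous map between `G`-spaces is a `G`-map if it commutes with the actions. -/
def IsGMap (G : Type*) [Group G] {X Y : Type*} [TopologicalSpace X] [MulAction G X]
    [TopologicalSpace Y] [MulAction G Y] (f : C(X, Y)) : Prop :=
  ∀ (g : G) (x : X), f (g • x) = g • f x

/-- The square with top `f : A → B`, left `u : A → C`, right `h : B → X` and bottom `k : C → X`
is a pushout in the category of `G`-spaces and `G`-maps. -/
structure IsGPushout (G : Type u) [Group G] [TopologicalSpace G] {A B C X : Type u}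
    [TopologicalSpace A] [MulAction G A] [TopologicalSpace B] [MulAction G B]
    [TopologicalSpace C] [MulAction G C] [TopologicalSpace X] [MulAction G X]
    (f : C(A, B)) (u : C(A, C)) (h : C(B, X)) (k : C(C, X)) : Prop where
  top_equivariant : IsGMap G f
  left_equivariant : IsGMap G u
  right_equivariant : IsGMap G h
  bottom_equivariant : IsGMap G k
  comm : h.comp f = k.comp u
  universal : ∀ (Z : Type u) [TopologicalSpace Z] [MulAction G Z] [ContinuousSMul G Z]
    (φ : C(B, Z)) (ψ : C(C, Z)), IsGMap G φ → IsGMap G ψ → φ.comp f = ψ.comp u →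
    ∃! χ : C(X, Z), IsGMap G χ ∧ χ.comp h = φ ∧ χ.comp k = ψ

/-! ### `G`-CW-complexes -/

/-- The closed unit disk `D^n`. -/
abbrev CellDisk (n : ℕ) : Type := Metric.closedBall (0 : EuclideanSpace ℝ (Fin n)) 1

/-- The unit sphere `S^{n-1}`, empty for `n = 0`. -/
abbrev CellSphere (n : ℕ) : Type := Metric.sphere (0 : EuclideanSpace ℝ (Fin n)) 1

/-- The inclusion `S^{n-1} → D^n`. -/
def cellBoundaryInclusion (n : ℕ) : C(CellSphere n, CellDisk n) :=
  ContinuousMap.inclusion Metric.sphere_subset_closedBall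

/-- The product `G/H × D`, with the product topology and `G` acting on the first factor only. -/
def OrbitProd {G : Type*} [Group G] (H : Subgroup G) (D : Type*) : Type _ := (G ⧸ H) × D

namespace OrbitProd

variable {G : Type*} [Group G] [TopologicalSpace G] (H : Subgroup G)

instance (D : Type*) [TopologicalSpace D] : TopologicalSpace (OrbitProd H D) :=
  inferInstanceAs (TopologicalSpace ((G ⧸ H) × D))

instance (D : Type*) : MulAction G (OrbitProd H D) where
  smul g p := (g • p.1, p.2)
  one_smul p := Prod.ext (one_smul G p.1) rfl
  mul_smul a b p := Prod.ext (mul_smul a b p.1) rfl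

/-- The map `id × f : G/H × D → G/H × D'`. -/
def map {D D' : Type*} [TopologicalSpace D] [TopologicalSpace D'] (f : C(D, D')) :
    C(OrbitProd H D, OrbitProd H D') where
  toFun p := (p.1, f p.2)
  continuous_toFun :=
    (continuous_fst.prodMk (f.continuous.comp continuous_snd) :
      Continuous fun p : (G ⧸ H) × D => (p.1, f p.2))

end OrbitProd

/-- The map `∐ i, G/H_i × S^{n-1} → ∐ i, G/H_i × D^n`. -/
def cellsBoundaryInclusion {G : Type*} [Group G] [TopologicalSpace G] (n : ℕ) {ι : Type*}
    (H : ι → Subgroup G) :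
    C((Σ i, OrbitProd (H i) (CellSphere n)), (Σ i, OrbitProd (H i) (CellDisk n))) where
  toFun := Sigma.map id fun i => OrbitProd.map (H i) (cellBoundaryInclusion n)
  continuous_toFun := Continuous.sigma_map fun i =>
    (OrbitProd.map (H i) (cellBoundaryInclusion n)).continuous

/-- The structure of a `G`-CW-complex on a `G`-space `X`.  The indices of the filtration are
shifted by one: `skel n` is `X_{n-1}`, so that `skel 0 = X_{-1}` is empty, and `skel (n + 1) = X_n`
is obtained from `skel n = X_{n-1}` by attaching equivariant cells `G/H_i × D^n`. -/
structure GCWComplex (G : Type u) [Group G] [TopologicalSpace G] (X : Type u)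
    [TopologicalSpace X] [MulAction G X] where
  /-- `skel n` is the `(n - 1)`-skeleton. -/
  skel : ℕ → SubMulAction G X
  skel_zero : skel 0 = ⊥
  skel_mono : Monotone skel
  skel_exhaust : ∀ x : X, ∃ n, x ∈ skel n
  /-- `X` carries the colimit topology. -/
  isClosed_of_skel : ∀ A : Set X,
    (∀ n, IsClosed ((↑) ⁻¹' A : Set (skel n))) → IsClosed A
  /-- The index set of the equivariant `n`-cells. -/
  cell : ℕ → Type u
  /-- The type `G/H` of an equivariant cell. -/
  isotropy : ∀ n, cell n → Subgroup G
  /-- The attaching maps of the equivariant `n`-cells. -/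
  attach : ∀ n, C((Σ i, OrbitProd (isotropy n i) (CellSphere n)), skel n)
  /-- The characteristic maps of the equivariant `n`-cells. -/
  char : ∀ n, C((Σ i, OrbitProd (isotropy n i) (CellDisk n)), skel (n + 1))
  isGPushout : ∀ n, IsGPushout G (attach n) (cellsBoundaryInclusion n (isotropy n))
    (ContinuousMap.inclusion (s := (skel n : Set X)) (t := (skel (n + 1) : Set X))
      (skel_mono n.le_succ)) (char n)

namespace GCWComplex

variable {G : Type u} [Group G] [TopologicalSpace G] {X : Type u}
  [TopologicalSpace X] [MulAction G X]

/-- The open equivariant `n`-cell with index `i`, as a subset of `X`. -/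
def openCell (c : GCWComplex G X) (n : ℕ) (i : c.cell n) : Set X :=
  {x | ∃ (a : G ⧸ c.isotropy n i) (d : CellDisk n),
    ‖(d : EuclideanSpace ℝ (Fin n))‖ < 1 ∧ x = c.char n ⟨i, (a, d)⟩}

/-- A `G`-CW-subcomplex: a closed union of open equivariant cells. -/
def IsSubcomplex (c : GCWComplex G X) (A : Set X) : Prop :=
  IsClosed A ∧ ∃ J : ∀ n, Set (c.cell n), A = ⋃ (n : ℕ) (i ∈ J n), c.openCell n i

end GCWComplex

/-! ### Classifying spaces for families of subgroups -/

/-- `X` is a model for the classifying `G`-CW-complex `E_F(G)` of the family `F`: it is a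
`G`-CW-complex, its isotropy groups belong to `F`, and for every `G`-CW-complex `Y` whose isotropy
groups belong to `F` there is up to `G`-homotopy precisely one `G`-map `Y → X`. -/
structure IsClassifyingGCW (G : Type u) [Group G] [TopologicalSpace G] (F : Set (Subgroup G))
    (X : Type u) [TopologicalSpace X] [MulAction G X] : Prop where
  isGCW : Nonempty (GCWComplex G X)
  stabilizer_mem : ∀ x : X, MulAction.stabilizer G x ∈ F
  universal : ∀ (Y : Type u) [TopologicalSpace Y] [MulAction G Y] [ContinuousSMul G Y],
    Nonempty (GCWComplex G Y) → (∀ y : Y, MulAction.stabilizer G y ∈ F) →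
    ∃ f : C(Y, X), IsGMap G f ∧
      ∀ f' : C(Y, X), IsGMap G f' → ContinuousMap.HomotopicWith f f' (IsGMap G)

/-- `X` is a model for `EG`, the classifying space for the family consisting of the trivial
subgroup. -/
def IsModelEG (G : Type u) [Group G] [TopologicalSpace G] (X : Type u) [TopologicalSpace X]
    [MulAction G X] : Prop :=
  IsClassifyingGCW G {⊥} X

/-- `X` is a model for the classifying space for proper actions of a discrete group `G`, that is,
the classifying space for the family of finite subgroups. -/
def IsModelProperEG (G : Type u) [Group G] [TopologicalSpace G] (X : Type u) [TopologicalSpace X]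
    [MulAction G X] : Prop :=
  IsClassifyingGCW G {H | Finite H} X

/-! ### Maximal finite subgroups -/

/-- `M` is a maximal element of the set of finite subgroups. -/
def IsMaximalFinite {G : Type*} [Group G] (M : Subgroup G) : Prop :=
  Maximal (fun H : Subgroup G => Finite H) M

/-- Every nontrivial finite subgroup is contained in a unique maximal finite subgroup. -/
def ConditionM (G : Type*) [Group G] : Prop :=
  ∀ H : Subgroup G, Finite H → H ≠ ⊥ → ∃! M : Subgroup G, IsMaximalFinite M ∧ H ≤ M

/-- Every nontrivial maximal finite subgroup is its own normalizer. -/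
def ConditionNM (G : Type*) [Group G] : Prop :=
  ∀ M : Subgroup G, IsMaximalFinite M → M ≠ ⊥ → Subgroup.normalizer (M : Set G) = M

/-! ### Induced spaces -/

/-- The relation `(g m, e) ∼ (g, m e)` for `m ∈ M` on `G × E`. -/
def inducedSetoid {G : Type*} [Group G] (M : Subgroup G) (E : Type*) [MulAction M E] :
    Setoid (G × E) where
  r p q := ∃ m : M, p.1 = q.1 * m ∧ m • p.2 = q.2
  iseqv :=
    { refl := fun p => ⟨1, by simp, one_smul M p.2⟩
      symm := by
        rintro p q ⟨m, h1, h2⟩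
        exact ⟨m⁻¹, by simp [h1], by rw [← h2, inv_smul_smul]⟩
      trans := by
        rintro p q r ⟨m, h1, h2⟩ ⟨m', h1', h2'⟩
        exact ⟨m' * m, by simp [h1, h1', mul_assoc], by rw [mul_smul, h2, h2']⟩ }

/-- The induced `G`-space `G ×_M E` of an `M`-space `E`. -/
def InducedSpace {G : Type*} [Group G] (M : Subgroup G) (E : Type*) [MulAction M E] : Type _ :=
  Quotient (inducedSetoid M E)

namespace InducedSpace

instance {G : Type*} [Group G] [TopologicalSpace G] (M : Subgroup G) (E : Type*)
    [TopologicalSpace E] [MulAction M E] : TopologicalSpace (InducedSpace M E) :=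
  inferInstanceAs (TopologicalSpace (Quotient (inducedSetoid M E)))

theorem smul_rel {G : Type*} [Group G] (M : Subgroup G) (E : Type*) [MulAction M E]
    (g : G) (p q : G × E) (h : (inducedSetoid M E).r p q) :
    (inducedSetoid M E).r (g * p.1, p.2) (g * q.1, q.2) := by
  obtain ⟨m, h1, h2⟩ := h
  exact ⟨m, by simp [h1, mul_assoc], h2⟩

instance {G : Type*} [Group G] (M : Subgroup G) (E : Type*) [MulAction M E] :
    MulAction G (InducedSpace M E) where
  smul g := Quotient.map (fun p : G × E => (g * p.1, p.2)) (smul_rel M E g)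
  one_smul := by
    rintro ⟨p⟩
    exact congrArg (Quotient.mk (inducedSetoid M E)) (Prod.ext (one_mul p.1) rfl)
  mul_smul := by
    rintro a b ⟨p⟩
    exact congrArg (Quotient.mk (inducedSetoid M E)) (Prod.ext (mul_assoc a b p.1) rfl)

/-- The map `G ×_M E → G/M`, `[g, e] ↦ gM`, collapsing `E` to a point. -/
def collapse {G : Type*} [Group G] [TopologicalSpace G] (M : Subgroup G) (E : Type*)
    [TopologicalSpace E] [MulAction M E] : C(InducedSpace M E, G ⧸ M) where
  toFun := Quotient.lift (fun p : G × E => (QuotientGroup.mk p.1 : G ⧸ M)) (by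
    rintro p q ⟨m, h1, -⟩
    rw [h1]
    exact QuotientGroup.mk_mul_of_mem q.1 m.2)
  continuous_toFun := Continuous.quotient_lift (by fun_prop) _

end InducedSpace

/-- The map `∐ i, G ×_{M_i} E_i → ∐ i, G/M_i` collapsing each `E_i` to a point. -/
def collapseMaps {G : Type*} [Group G] [TopologicalSpace G] {ι : Type*} (M : ι → Subgroup G)
    (E : ι → Type*) [∀ i, TopologicalSpace (E i)] [∀ i, MulAction (M i) (E i)] :
    C((Σ i, InducedSpace (M i) (E i)), (Σ i, G ⧸ M i)) where
  toFun := Sigma.map id fun i => InducedSpace.collapse (M i) (E i)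
  continuous_toFun := Continuous.sigma_map fun i => (InducedSpace.collapse (M i) (E i)).continuous

/-! ### Pushouts along an injective map -/

theorem continuousSMul_of_discreteTopology {G X : Type*} [TopologicalSpace G] [DiscreteTopology G]
    [TopologicalSpace X] [SMul G X] [ContinuousConstSMul G X] : ContinuousSMul G X :=
  ⟨continuous_prod_of_discrete_left.2 fun g => continuous_const_smul g⟩

/-- The commutative square with top `f : A → B`, left `u : A → C`, right `h : B → X` and bottom
`k : C → X` exhibits `X` as the space obtained by gluing `B` and `C` along `A`, where `u` is
injective. -/
structure IsGluing {A B C X : Type*} [TopologicalSpace B] [TopologicalSpace C] [TopologicalSpace X]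
    (f : A → B) (u : A → C) (h : B → X) (k : C → X) : Prop where
  comm : ∀ a, h (f a) = k (u a)
  injective : Function.Injective h
  eq_imp : ∀ b c, h b = k c → ∃ a, f a = b ∧ u a = c
  eq_or_mem : ∀ c c', k c = k c' → c = c' ∨ c ∈ Set.range u ∧ c' ∈ Set.range u
  cover : ∀ x, (∃ b, h b = x) ∨ ∃ c, c ∉ Set.range u ∧ k c = x
  isClosed : ∀ S : Set X, IsClosed (h ⁻¹' S) → IsClosed (k ⁻¹' S) → IsClosed S

/-- The set underlying a pushout along an injective map. -/
def GluedSpace {A C : Type*} (B : Type*) (u : A → C) : Type _ := B ⊕ {c // c ∉ Set.range u}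

namespace GluedSpace

variable {A B C : Type*} {f : A → B} {u : A → C}

/-- The inclusion of the first summand. -/
def inl (u : A → C) (b : B) : GluedSpace B u := Sum.inl b

open Classical in
/-- The canonical map from the second summand. -/
noncomputable def inr (f : A → B) (u : A → C) (c : C) : GluedSpace B u :=
  if h : c ∈ Set.range u then Sum.inl (f h.choose) else Sum.inr ⟨c, h⟩

theorem inr_of_notMem {c : C} (hc : c ∉ Set.range u) : inr f u c = Sum.inr ⟨c, hc⟩ :=
  dif_neg hc

theorem inr_apply (hu : Function.Injective u) (a : A) : inr f u (u a) = inl u (f a) := by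
  have h : u a ∈ Set.range u := ⟨a, rfl⟩
  have : h.choose = a := hu h.choose_spec
  exact (dif_pos h).trans (congrArg (fun a => Sum.inl (f a)) this)

theorem cases (f : A → B) (z : GluedSpace B u) :
    (∃ b, inl u b = z) ∨ ∃ c, c ∉ Set.range u ∧ inr f u c = z := by
  rcases z with b | ⟨c, hc⟩
  · exact Or.inl ⟨b, rfl⟩
  · exact Or.inr ⟨c, hc, inr_of_notMem hc⟩

/-- The gluing topology. -/
noncomputable abbrev topology [TopologicalSpace B] [TopologicalSpace C] (f : A → B) (u : A → C) :
    TopologicalSpace (GluedSpace B u) :=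
  .coinduced (inl u) ‹_› ⊔ .coinduced (inr f u) ‹_›

/-- The action on a space glued from `G`-spaces along `G`-maps. -/
abbrev mulAction {G : Type*} [Group G] [MulAction G A] [MulAction G B] [MulAction G C]
    (hu : ∀ (g : G) a, u (g • a) = g • u a) : MulAction G (GluedSpace B u) :=
  have key : ∀ (g : G) (c : C), c ∉ Set.range u → g • c ∉ Set.range u := by
    rintro g c hc ⟨a, ha⟩
    exact hc ⟨g⁻¹ • a, by rw [hu, ha, inv_smul_smul]⟩
  { smul := fun g z => Sum.map (fun b => g • b) (fun c => ⟨g • c.1, key g c.1 c.2⟩) z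
    one_smul := by
      rintro (b | c)
      · exact congrArg Sum.inl (one_smul G b)
      · exact congrArg Sum.inr (Subtype.ext (one_smul G c.1))
    mul_smul := by
      rintro g g' (b | c)
      · exact congrArg Sum.inl (mul_smul g g' b)
      · exact congrArg Sum.inr (Subtype.ext (mul_smul g g' c.1)) }

theorem isGluing [TopologicalSpace B] [TopologicalSpace C] (hu : Function.Injective u) :
    letI := topology f u
    IsGluing f u (inl u) (inr f u) := by
  let := topology f u
  refine ⟨fun a => (inr_apply hu a).symm, Sum.inl_injective, ?_, ?_, cases f, ?_⟩
  · intro b c h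
    by_cases hc : c ∈ Set.range u
    · obtain ⟨a, rfl⟩ := hc
      rw [inr_apply hu] at h
      exact ⟨a, (Sum.inl_injective h).symm, rfl⟩
    · rw [inr_of_notMem hc] at h
      exact absurd h Sum.inl_ne_inr
  · intro c c' h
    by_cases hc : c ∈ Set.range u <;> by_cases hc' : c' ∈ Set.range u
    · exact Or.inr ⟨hc, hc'⟩
    · obtain ⟨a, rfl⟩ := hc
      rw [inr_apply hu, inr_of_notMem hc'] at h
      exact absurd h Sum.inl_ne_inr
    · obtain ⟨a, rfl⟩ := hc'
      rw [inr_apply hu, inr_of_notMem hc] at h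
      exact absurd h Sum.inr_ne_inl
    · rw [inr_of_notMem hc, inr_of_notMem hc'] at h
      exact Or.inl (Subtype.mk.inj (Sum.inr_injective h))
  · intro S h1 h2
    rw [← isOpen_compl_iff]
    exact ⟨h1.isOpen_compl, h2.isOpen_compl⟩

end GluedSpace

namespace IsGluing

variable {A B C X : Type*} [TopologicalSpace B] [TopologicalSpace C] [TopologicalSpace X]
  {f : A → B} {u : A → C} {h : B → X} {k : C → X}

/-- A map out of a glued space. -/
theorem exists_desc (H : IsGluing f u h k) {Z : Type*} [TopologicalSpace Z] (φ : C(B, Z))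
    (ψ : C(C, Z)) (comm : ∀ a, φ (f a) = ψ (u a)) :
    ∃ χ : C(X, Z), (∀ b, χ (h b) = φ b) ∧ ∀ c, χ (k c) = ψ c := by
  classical
  let χ : X → Z := fun x =>
    if hb : ∃ b, h b = x then φ hb.choose
    else if hc : ∃ c, k c = x then ψ hc.choose else φ ((H.cover x).resolve_right
      fun ⟨c, _, hc'⟩ => hc ⟨c, hc'⟩).choose
  have h1 : ∀ b, χ (h b) = φ b := by
    intro b
    have hb : ∃ b', h b' = h b := ⟨b, rfl⟩
    have : hb.choose = b := H.injective hb.choose_spec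
    simp only [χ, dif_pos hb, this]
  have h2 : ∀ c, χ (k c) = ψ c := by
    intro c
    by_cases hb : ∃ b, h b = k c
    · obtain ⟨b, hb⟩ := hb
      obtain ⟨a, rfl, rfl⟩ := H.eq_imp b c hb
      rw [← hb, h1, comm]
    · have hc : ∃ c', k c' = k c := ⟨c, rfl⟩
      have : hc.choose = c := by
        rcases H.eq_or_mem _ _ hc.choose_spec with e | ⟨-, a, rfl⟩
        · exact e
        · exact absurd ⟨f a, H.comm a⟩ hb
      simp only [χ, dif_neg hb, dif_pos hc, this]
  refine ⟨⟨χ, continuous_iff_isClosed.2 fun S hS => H.isClosed _ ?_ ?_⟩, h1, h2⟩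
  · rw [← Set.preimage_comp, show χ ∘ h = φ from funext h1]
    exact hS.preimage φ.continuous
  · rw [← Set.preimage_comp, show χ ∘ k = ψ from funext h2]
    exact hS.preimage ψ.continuous

theorem hom_ext (H : IsGluing f u h k) {Z : Type*} {χ χ' : X → Z}
    (h1 : ∀ b, χ (h b) = χ' (h b)) (h2 : ∀ c, χ (k c) = χ' (k c)) : χ = χ' := by
  funext x
  rcases H.cover x with ⟨b, rfl⟩ | ⟨c, -, rfl⟩
  exacts [h1 b, h2 c]

/-- Transport of a gluing along a homeomorphism. -/
theorem congr (H : IsGluing f u h k) {X' : Type*} [TopologicalSpace X'] (e : X ≃ₜ X') :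
    IsGluing f u (e ∘ h) (e ∘ k) where
  comm a := congrArg e (H.comm a)
  injective := e.injective.comp H.injective
  eq_imp b c hbc := H.eq_imp b c (e.injective hbc)
  eq_or_mem c c' hc := H.eq_or_mem c c' (e.injective hc)
  cover x := by
    rcases H.cover (e.symm x) with ⟨b, hb⟩ | ⟨c, hc, hc'⟩
    · exact Or.inl ⟨b, by simp [hb]⟩
    · exact Or.inr ⟨c, hc, by simp [hc']⟩
  isClosed S h1 h2 := by
    rw [Set.preimage_comp] at h1 h2
    exact e.isClosed_preimage.1 (H.isClosed _ h1 h2)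

end IsGluing

section

variable {G : Type u} [Group G] [TopologicalSpace G] {A B C X : Type u}
  [TopologicalSpace A] [MulAction G A] [TopologicalSpace B] [MulAction G B]
  [TopologicalSpace C] [MulAction G C] [TopologicalSpace X] [MulAction G X]
  {f : C(A, B)} {u : C(A, C)} {h : C(B, X)} {k : C(C, X)}

theorem IsGluing.isGPushout (H : IsGluing f u h k) (hf : IsGMap G f) (hu : IsGMap G u)
    (hh : IsGMap G h) (hk : IsGMap G k) : IsGPushout G f u h k := by
  refine ⟨hf, hu, hh, hk, ContinuousMap.ext H.comm, ?_⟩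
  intro Z _ _ _ φ ψ hφ hψ comm
  obtain ⟨χ, h1, h2⟩ := H.exists_desc φ ψ fun a => DFunLike.congr_fun comm a
  refine ⟨χ, ⟨fun g x => ?_, ContinuousMap.ext h1, ContinuousMap.ext h2⟩, ?_⟩
  · rcases H.cover x with ⟨b, rfl⟩ | ⟨c, -, rfl⟩
    · rw [← hh, h1, h1, hφ]
    · rw [← hk, h2, h2, hψ]
  · rintro χ' ⟨-, rfl, rfl⟩
    exact DFunLike.coe_injective (H.hom_ext (fun b => (h1 b).symm) fun c => (h2 c).symm)

theorem IsGPushout.symm (H : IsGPushout G f u h k) : IsGPushout G u f k h :=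
  ⟨H.left_equivariant, H.top_equivariant, H.bottom_equivariant, H.right_equivariant, H.comm.symm,
    fun Z _ _ _ φ ψ hφ hψ e => by
      obtain ⟨χ, ⟨h1, h2, h3⟩, h4⟩ := H.universal Z ψ φ hψ hφ e.symm
      exact ⟨χ, ⟨h1, h3, h2⟩, fun χ' h' => h4 χ' ⟨h'.1, h'.2.2, h'.2.1⟩⟩⟩

theorem IsGPushout.isGluing [DiscreteTopology G] [ContinuousSMul G B] [ContinuousSMul G C]
    [ContinuousSMul G X]
    (H : IsGPushout G f u h k) (hu : Function.Injective u) : IsGluing f u h k := by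
  let Z : Type u := GluedSpace B u
  let : TopologicalSpace Z := GluedSpace.topology f u
  let : MulAction G Z := GluedSpace.mulAction H.left_equivariant
  have glue : IsGluing f u (GluedSpace.inl u : B → Z) (GluedSpace.inr f u) :=
    GluedSpace.isGluing hu
  let h' : C(B, Z) := ⟨GluedSpace.inl u, continuous_iff_coinduced_le.2 le_sup_left⟩
  let k' : C(C, Z) := ⟨GluedSpace.inr f u, continuous_iff_coinduced_le.2 le_sup_right⟩
  have hh' : IsGMap G h' := fun g b => rfl
  have hk' : IsGMap G k' := by
    intro g c
    by_cases hc : c ∈ Set.range u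
    · obtain ⟨a, rfl⟩ := hc
      rw [← H.left_equivariant]
      change GluedSpace.inr f u _ = g • GluedSpace.inr f u _
      rw [GluedSpace.inr_apply hu, GluedSpace.inr_apply hu, H.top_equivariant]
      rfl
    · have hc' : g • c ∉ Set.range u := by
        rintro ⟨a, ha⟩
        exact hc ⟨g⁻¹ • a, by rw [H.left_equivariant, ha, inv_smul_smul]⟩
      change GluedSpace.inr f u _ = g • GluedSpace.inr f u _
      rw [GluedSpace.inr_of_notMem hc, GluedSpace.inr_of_notMem hc']
      rfl
  have : ContinuousConstSMul G Z := by
    refine ⟨fun g => continuous_iff_isClosed.2 fun S hS => glue.isClosed _ ?_ ?_⟩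
    · rw [← Set.preimage_comp, show (fun z : Z => g • z) ∘ GluedSpace.inl u = h' ∘ fun b => g • b
        from funext fun b => (hh' g b).symm]
      exact hS.preimage (h'.continuous.comp (continuous_const_smul g))
    · rw [← Set.preimage_comp, show (fun z : Z => g • z) ∘ GluedSpace.inr f u = k' ∘ fun b => g • b
        from funext fun b => (hk' g b).symm]
      exact hS.preimage (k'.continuous.comp (continuous_const_smul g))
  have : ContinuousSMul G Z := continuousSMul_of_discreteTopology
  have comm' : h'.comp f = k'.comp u := ContinuousMap.ext glue.comm
  obtain ⟨θ, hθh, hθk⟩ := glue.exists_desc h k fun a => DFunLike.congr_fun H.comm a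
  have hθ : IsGMap G θ := by
    intro g z
    rcases glue.cover z with ⟨b, rfl⟩ | ⟨c, -, rfl⟩
    · rw [hθh, ← H.right_equivariant, ← hθh]; exact congrArg θ (hh' g b).symm
    · rw [hθk, ← H.bottom_equivariant, ← hθk]; exact congrArg θ (hk' g c).symm
  obtain ⟨χ', ⟨hχ', hχ'h, hχ'k⟩, -⟩ := H.universal Z h' k' hh' hk' comm'
  obtain ⟨_, -, huniq⟩ := H.universal X h k H.right_equivariant H.bottom_equivariant H.comm
  have e2 : θ.comp χ' = ContinuousMap.id X := by
    rw [huniq (θ.comp χ') ⟨fun g x => by simp [hχ' g x, hθ g],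
        by rw [ContinuousMap.comp_assoc, hχ'h]; exact ContinuousMap.ext hθh,
        by rw [ContinuousMap.comp_assoc, hχ'k]; exact ContinuousMap.ext hθk⟩]
    exact (huniq (ContinuousMap.id X) ⟨fun _ _ => rfl, rfl, rfl⟩).symm
  have e1' : ∀ z, χ' (θ z) = z := fun z => by
    refine congrFun (glue.hom_ext (χ := χ' ∘ θ) (χ' := id) ?_ ?_) z
    · intro b; simp only [Function.comp, hθh]; exact DFunLike.congr_fun hχ'h b
    · intro c; simp only [Function.comp, hθk]; exact DFunLike.congr_fun hχ'k c
  let e : Z ≃ₜ X :=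
    { toFun := θ, invFun := χ', left_inv := e1', right_inv := fun x => DFunLike.congr_fun e2 x
      continuous_toFun := θ.continuous, continuous_invFun := χ'.continuous }
  have := glue.congr e
  rwa [show e ∘ GluedSpace.inl u = h from funext hθh,
    show e ∘ GluedSpace.inr f u = k from funext hθk] at this

end

/-! ### Equivariant cells -/

instance QuotientGroup.discreteTopology_of_discrete {G : Type*} [Group G] [TopologicalSpace G]
    [DiscreteTopology G] (H : Subgroup G) : DiscreteTopology (G ⧸ H) :=
  QuotientGroup.discreteTopology (isOpen_discrete _)

instance Sigma.continuousConstSMul {G ι : Type*} {X : ι → Type*} [∀ i, SMul G (X i)]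
    [∀ i, TopologicalSpace (X i)] [∀ i, ContinuousConstSMul G (X i)] :
    ContinuousConstSMul G (Σ i, X i) :=
  ⟨fun g => Continuous.sigma_map fun _ => continuous_const_smul g⟩

namespace OrbitProd

variable {G : Type*} [Group G] {H : Subgroup G} {D Z : Type*}

/-- The point of `G/H × D` with the given coordinates. -/
def mk (a : G ⧸ H) (d : D) : OrbitProd H D := (a, d)

theorem smul_mk (g : G) (a : G ⧸ H) (d : D) : g • mk a d = mk (g • a) d := rfl

variable [TopologicalSpace G] [DiscreteTopology G] [TopologicalSpace D] [TopologicalSpace Z]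

theorem continuous_iff {f : OrbitProd H D → Z} :
    Continuous f ↔ ∀ a, Continuous fun d => f (mk a d) :=
  continuous_prod_of_discrete_left

theorem continuous_mk (a : G ⧸ H) : Continuous fun d : D => mk a d :=
  continuous_iff.1 continuous_id a

theorem isClosed_iff {S : Set (OrbitProd H D)} :
    IsClosed S ↔ ∀ a, IsClosed {d | mk a d ∈ S} := by
  simp only [← isOpen_compl_iff, ← continuous_Prop, Set.compl_def, Set.mem_ofPred_eq]
  exact continuous_iff

instance : ContinuousConstSMul G (OrbitProd H D) :=
  ⟨fun g => continuous_iff.2 fun a => continuous_mk (g • a)⟩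

instance : ContinuousSMul G (OrbitProd H D) := continuousSMul_of_discreteTopology

end OrbitProd

section Cells

variable {G : Type*} [Group G] [TopologicalSpace G] {ι : Type*} {H : ι → Subgroup G} {n : ℕ}

instance [DiscreteTopology G] {D : Type*} [TopologicalSpace D] :
    ContinuousSMul G (Σ i, OrbitProd (H i) D) := continuousSMul_of_discreteTopology

theorem isGMap_cellsBoundaryInclusion : IsGMap G (cellsBoundaryInclusion n H) := fun _ _ => rfl

theorem cellBoundaryInclusion_injective : Function.Injective (cellBoundaryInclusion n) :=
  Set.inclusion_injective Metric.sphere_subset_closedBall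

theorem mem_range_cellBoundaryInclusion {d : CellDisk n} :
    d ∈ Set.range (cellBoundaryInclusion n) ↔ ‖(d : EuclideanSpace ℝ (Fin n))‖ = 1 := by
  constructor
  · rintro ⟨s, rfl⟩
    exact mem_sphere_zero_iff_norm.1 s.2
  · intro h
    exact ⟨⟨d, mem_sphere_zero_iff_norm.2 h⟩, rfl⟩

theorem cellsBoundaryInclusion_injective :
    Function.Injective (cellsBoundaryInclusion n H) := by
  rintro ⟨i, a, s⟩ ⟨j, b, t⟩ h
  obtain rfl : i = j := congrArg Sigma.fst h
  have h := eq_of_heq (Sigma.mk.inj_iff.1 h).2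
  have h1 : a = b := congrArg Prod.fst h
  have h2 : s = t := cellBoundaryInclusion_injective (congrArg Prod.snd h)
  rw [h1, h2]

theorem mem_range_cellsBoundaryInclusion {p : Σ i, OrbitProd (H i) (CellDisk n)} :
    p ∈ Set.range (cellsBoundaryInclusion n H) ↔
      ‖(p.2.2 : EuclideanSpace ℝ (Fin n))‖ = 1 := by
  rw [← mem_range_cellBoundaryInclusion]
  constructor
  · rintro ⟨q, rfl⟩
    exact ⟨q.2.2, rfl⟩
  · rintro ⟨s, hs⟩
    exact ⟨⟨p.1, OrbitProd.mk p.2.1 s⟩, Sigma.ext rfl (heq_of_eq (Prod.ext rfl hs))⟩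

theorem notMem_range_cellsBoundaryInclusion {p : Σ i, OrbitProd (H i) (CellDisk n)} :
    p ∉ Set.range (cellsBoundaryInclusion n H) ↔
      ‖(p.2.2 : EuclideanSpace ℝ (Fin n))‖ < 1 := by
  rw [mem_range_cellsBoundaryInclusion, (mem_closedBall_zero_iff.1 p.2.2.2).lt_iff_ne]

instance : IsEmpty (CellSphere 0) :=
  ⟨fun x => by simpa [Subsingleton.elim x.1 0] using x.2⟩

/-- The centre of the disk. -/
def CellDisk.center (n : ℕ) : CellDisk n := ⟨0, by simp⟩

theorem dense_interior_cellDisk (hn : n ≠ 0) :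
    Dense {d : CellDisk n | ‖(d : EuclideanSpace ℝ (Fin n))‖ < 1} := by
  have : Nonempty (Fin n) := ⟨⟨0, Nat.pos_of_ne_zero hn⟩⟩
  intro d
  rw [Topology.IsInducing.subtypeVal.closure_eq_preimage_closure_image, Set.mem_preimage]
  have : ((↑) : CellDisk n → EuclideanSpace ℝ (Fin n)) ''
      {d : CellDisk n | ‖(d : EuclideanSpace ℝ (Fin n))‖ < 1} = Metric.ball 0 1 := by
    ext x
    constructor
    · rintro ⟨d, hd, rfl⟩
      exact mem_ball_zero_iff.2 hd
    · intro hx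
      exact ⟨⟨x, Metric.ball_subset_closedBall hx⟩, mem_ball_zero_iff.1 hx, rfl⟩
  rw [this, closure_ball _ one_ne_zero]
  exact d.2

variable [DiscreteTopology G]

theorem continuous_cells_iff {D Z : Type*} [TopologicalSpace D] [TopologicalSpace Z]
    {f : (Σ i, OrbitProd (H i) D) → Z} :
    Continuous f ↔ ∀ i a, Continuous fun d => f ⟨i, OrbitProd.mk a d⟩ := by
  rw [continuous_sigma_iff]
  exact forall_congr' fun i => OrbitProd.continuous_iff

theorem isClosed_cells_iff {D : Type*} [TopologicalSpace D] {S : Set (Σ i, OrbitProd (H i) D)} :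
    IsClosed S ↔ ∀ i a, IsClosed {d | (⟨i, OrbitProd.mk a d⟩ : Σ i, OrbitProd (H i) D) ∈ S} := by
  rw [isClosed_sigma_iff]
  exact forall_congr' fun i => OrbitProd.isClosed_iff

theorem isClosed_range_cellsBoundaryInclusion :
    IsClosed (Set.range (cellsBoundaryInclusion n H)) := by
  rw [isClosed_cells_iff]
  intro i a
  simp only [mem_range_cellsBoundaryInclusion]
  exact isClosed_eq (continuous_norm.comp continuous_subtype_val) continuous_const

/-- The `G`-map out of a disjoint union of equivariant cells determined by maps whose values are
fixed by the isotropy groups. -/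
theorem exists_cells_desc {D P : Type*} [TopologicalSpace D] [TopologicalSpace P]
    [MulAction G P] [ContinuousConstSMul G P] (τ : ι → C(D, P))
    (hτ : ∀ i d, ∀ g ∈ H i, g • τ i d = τ i d) :
    ∃ ψ : C((Σ i, OrbitProd (H i) D), P), IsGMap G ψ ∧
      ∀ i (g : G) d, ψ ⟨i, OrbitProd.mk (g : G ⧸ H i) d⟩ = g • τ i d := by
  let F (i : ι) (d : D) : G ⧸ H i → P := Quotient.lift (fun g : G => g • τ i d) <| by
    intro g g' h
    have h := QuotientGroup.leftRel_apply.1 h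
    exact (congrArg (g • ·) (hτ i d _ h)).symm.trans (by rw [smul_smul, mul_inv_cancel_left])
  have hF : ∀ i d (g : G), F i d g = g • τ i d := fun _ _ _ => rfl
  refine ⟨⟨fun p => F p.1 p.2.2 p.2.1, continuous_cells_iff.2 ?_⟩, ?_, fun i g d => rfl⟩
  · intro i a
    induction a using QuotientGroup.induction_on with
    | H g => exact (τ i).continuous.const_smul g
  · rintro g ⟨i, a, d⟩
    induction a using QuotientGroup.induction_on with
    | H g' => exact mul_smul g g' (τ i d)

end Cells

/-! ### Characteristic maps of `G`-CW-complexes -/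

namespace GCWComplex

variable {G : Type u} [Group G] [TopologicalSpace G] {X : Type u} [TopologicalSpace X]
  [MulAction G X] (c : GCWComplex G X)

/-- The characteristic maps of the equivariant `n`-cells, as a map to the complex. -/
def charMap (n : ℕ) : C((Σ i, OrbitProd (c.isotropy n i) (CellDisk n)), X) :=
  ⟨fun p => c.char n p, continuous_subtype_val.comp (c.char n).continuous⟩

theorem charMap_smul (n : ℕ) : IsGMap G (c.charMap n) := fun g p =>
  congrArg Subtype.val ((c.isGPushout n).bottom_equivariant g p)

theorem charMap_mem (n : ℕ) (p) : c.charMap n p ∈ c.skel (n + 1) := (c.char n p).2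

theorem charMap_boundary (n : ℕ) (p) :
    c.charMap n (cellsBoundaryInclusion n _ p) = c.attach n p :=
  congrArg Subtype.val (DFunLike.congr_fun (c.isGPushout n).comm p).symm

theorem charMap_mem_of_mem_range {n : ℕ} {p}
    (hp : p ∈ Set.range (cellsBoundaryInclusion n (c.isotropy n))) :
    c.charMap n p ∈ c.skel n := by
  obtain ⟨q, rfl⟩ := hp
  rw [charMap_boundary]
  exact (c.attach n q).2

theorem isClosed_of_inter {S : Set X} (h : ∀ n, IsClosed (S ∩ c.skel n)) : IsClosed S := by
  refine c.isClosed_of_skel S fun n => ?_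
  rw [← Subtype.preimage_coe_inter_self]
  exact (h n).preimage continuous_subtype_val

theorem smul_charMap_of_mem {n : ℕ} {i : c.cell n} {g : G} (hg : g ∈ c.isotropy n i)
    (d : CellDisk n) :
    g • c.charMap n ⟨i, OrbitProd.mk ((1 : G) : G ⧸ c.isotropy n i) d⟩
      = c.charMap n ⟨i, OrbitProd.mk ((1 : G) : G ⧸ c.isotropy n i) d⟩ := by
  rw [← charMap_smul, Sigma.smul_mk, OrbitProd.smul_mk]
  congr 3
  simpa [MulAction.Quotient.smul_mk, QuotientGroup.eq] using hg

theorem charMap_mem_subcomplex [DiscreteTopology G] {A : Set X}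
    {J : ∀ n, Set (c.cell n)} (hA : IsClosed A)
    (hJ : A = ⋃ (n : ℕ) (i ∈ J n), c.openCell n i) {n : ℕ} {i : c.cell n} (hi : i ∈ J n)
    (o : OrbitProd (c.isotropy n i) (CellDisk n)) : c.charMap n ⟨i, o⟩ ∈ A := by
  obtain ⟨a, d⟩ := o
  have key : ∀ d : CellDisk n, ‖(d : EuclideanSpace ℝ (Fin n))‖ < 1 →
      c.charMap n ⟨i, OrbitProd.mk a d⟩ ∈ A := by
    intro d hd
    rw [hJ]
    exact Set.mem_iUnion.2 ⟨n, Set.mem_iUnion₂.2 ⟨i, hi, a, d, hd, rfl⟩⟩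
  rcases eq_or_ne n 0 with rfl | hn
  · exact key d (by simp [Subsingleton.elim (d : EuclideanSpace ℝ (Fin 0)) 0])
  · have cont : Continuous fun d : CellDisk n => c.charMap n ⟨i, OrbitProd.mk a d⟩ :=
      continuous_cells_iff.1 (c.charMap n).continuous i a
    exact (closure_minimal key (hA.preimage cont)) (dense_interior_cellDisk hn d)

variable [DiscreteTopology G] [ContinuousSMul G X]

theorem isGluing (n : ℕ) : IsGluing (c.attach n) (cellsBoundaryInclusion n (c.isotropy n))
    (Set.inclusion (c.skel_mono n.le_succ)) (c.char n) :=
  (c.isGPushout n).isGluing cellsBoundaryInclusion_injective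

theorem charMap_notMem {n : ℕ} {p}
    (hp : p ∉ Set.range (cellsBoundaryInclusion n (c.isotropy n))) :
    c.charMap n p ∉ c.skel n := by
  intro h
  obtain ⟨a, -, ha⟩ := (c.isGluing n).eq_imp ⟨_, h⟩ p (Subtype.ext rfl)
  exact hp ⟨a, ha⟩

theorem charMap_mem_iff {n : ℕ} {p} : c.charMap n p ∈ c.skel n ↔
    p ∈ Set.range (cellsBoundaryInclusion n (c.isotropy n)) :=
  ⟨fun h => by_contra fun h' => c.charMap_notMem h' h, c.charMap_mem_of_mem_range⟩

theorem charMap_inj {n : ℕ} {p p'} (hp : c.charMap n p ∉ c.skel n)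
    (h : c.charMap n p = c.charMap n p') : p = p' :=
  ((c.isGluing n).eq_or_mem p p' (Subtype.ext h)).resolve_right fun h' =>
    hp (c.charMap_mem_of_mem_range h'.1)

theorem mem_skel_or (n : ℕ) {x : X} (hx : x ∈ c.skel (n + 1)) :
    x ∈ c.skel n ∨ ∃ p, c.charMap n p = x := by
  rcases (c.isGluing n).cover ⟨x, hx⟩ with ⟨b, hb⟩ | ⟨p, -, hp⟩
  · have : (b : X) = x := congrArg Subtype.val hb
    exact Or.inl (this ▸ b.2)
  · exact Or.inr ⟨p, congrArg Subtype.val hp⟩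

theorem isClosed_preimage_succ {n : ℕ} {S : Set X}
    (h : IsClosed ((↑) ⁻¹' S : Set (c.skel n))) (h' : IsClosed (c.charMap n ⁻¹' S)) :
    IsClosed ((↑) ⁻¹' S : Set (c.skel (n + 1))) :=
  (c.isGluing n).isClosed _ h h'

theorem isClosed_skel_succ (n : ℕ) :
    IsClosed ((↑) ⁻¹' (c.skel n : Set X) : Set (c.skel (n + 1))) := by
  refine c.isClosed_preimage_succ ?_ ?_
  · convert isClosed_univ
    exact Set.eq_univ_of_forall fun x => x.2
  · rw [show c.charMap n ⁻¹' (c.skel n : Set X)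
        = Set.range (cellsBoundaryInclusion n (c.isotropy n)) from
      Set.ext fun p => c.charMap_mem_iff]
    exact isClosed_range_cellsBoundaryInclusion

theorem isClosed_skel (n : ℕ) : IsClosed (c.skel n : Set X) := by
  refine c.isClosed_of_skel _ fun m => ?_
  rcases le_total m n with h | h
  · convert isClosed_univ
    exact Set.eq_univ_of_forall fun x => c.skel_mono h x.2
  · induction m, h using Nat.le_induction with
    | base =>
      convert isClosed_univ
      exact Set.eq_univ_of_forall fun x => x.2
    | succ m hm ih =>
      have hsub : (c.skel m : Set X) ⊆ c.skel (m + 1) := c.skel_mono m.le_succ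
      have emb : IsClosedEmbedding (Set.inclusion hsub) :=
        ⟨.inclusion hsub, by rw [Set.range_inclusion]; exact c.isClosed_skel_succ m⟩
      have key : ((↑) ⁻¹' (c.skel n : Set X) : Set (c.skel (m + 1)))
          = Set.inclusion hsub '' ((↑) ⁻¹' (c.skel n : Set X)) := by
        ext x
        constructor
        · intro hx
          exact ⟨⟨x, c.skel_mono hm hx⟩, hx, rfl⟩
        · rintro ⟨y, hy, rfl⟩
          exact hy
      rw [key]
      exact emb.isClosedMap _ ih

theorem isClosed_inter_succ {n : ℕ} {S : Set X} (h : IsClosed (S ∩ c.skel n))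
    (h' : IsClosed (c.charMap n ⁻¹' S)) : IsClosed (S ∩ c.skel (n + 1)) := by
  rw [Set.inter_comm, ← Subtype.image_preimage_coe]
  refine (c.isClosed_skel (n + 1)).isClosedEmbedding_subtypeVal.isClosedMap _
    (c.isClosed_preimage_succ ?_ h')
  rw [← Subtype.preimage_coe_inter_self]
  exact h.preimage continuous_subtype_val

/-- The centre of an equivariant cell. -/
def center (n : ℕ) (i : c.cell n) : X :=
  c.charMap n ⟨i, OrbitProd.mk ((1 : G) : G ⧸ c.isotropy n i) (CellDisk.center n)⟩

theorem stabilizer_center (n : ℕ) (i : c.cell n) :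
    MulAction.stabilizer G (c.center n i) = c.isotropy n i := by
  ext g
  rw [MulAction.mem_stabilizer_iff]
  refine ⟨fun h => ?_, fun h => c.smul_charMap_of_mem h _⟩
  have hmem : c.center n i ∉ c.skel n := c.charMap_notMem <|
    notMem_range_cellsBoundaryInclusion.2 (by simp [OrbitProd.mk, CellDisk.center])
  have h2 := c.charMap_inj (p' := g • _) hmem (h.symm.trans (c.charMap_smul n g _).symm)
  have h3 := congrArg Prod.fst (eq_of_heq (Sigma.mk.inj_iff.1 h2).2)
  simpa [OrbitProd.mk, QuotientGroup.eq, MulAction.Quotient.smul_mk] using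
    (show ((1 : G) : G ⧸ c.isotropy n i) = g • ((1 : G) : G ⧸ c.isotropy n i) from h3)

theorem mem_of_charMap_mem_subcomplex {A : Set X} {J : ∀ n, Set (c.cell n)}
    (hJ : A = ⋃ (n : ℕ) (i ∈ J n), c.openCell n i)
    {n : ℕ} {p} (hp : c.charMap n p ∉ c.skel n) (hA : c.charMap n p ∈ A) : p.1 ∈ J n := by
  rw [hJ] at hA
  obtain ⟨m, hA⟩ := Set.mem_iUnion.1 hA
  obtain ⟨i, hi, a, d, hd, h⟩ := Set.mem_iUnion₂.1 hA
  have h : c.charMap n p = c.charMap m ⟨i, OrbitProd.mk a d⟩ := h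
  have hm := c.charMap_notMem (n := m) (p := ⟨i, OrbitProd.mk a d⟩)
    (notMem_range_cellsBoundaryInclusion.2 hd)
  obtain rfl : n = m := by
    rcases lt_trichotomy n m with hnm | hnm | hnm
    · exact absurd (c.skel_mono hnm (c.charMap_mem n p)) (h ▸ hm)
    · exact hnm
    · exact absurd (c.skel_mono hnm (c.charMap_mem m _)) (h ▸ hp)
  rwa [c.charMap_inj hp h]

end GCWComplex

/-! ### Constructing `G`-CW-complexes -/

namespace GCWComplex

variable {G : Type u} [Group G] [TopologicalSpace G] [DiscreteTopology G] {X : Type u}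
  [TopologicalSpace X] [MulAction G X]

/-- A `G`-CW-complex structure from a filtration and characteristic maps with values in `X`. -/
def ofCharMap (skel : ℕ → SubMulAction G X) (skel_zero : skel 0 = ⊥) (skel_mono : Monotone skel)
    (skel_exhaust : ∀ x, ∃ n, x ∈ skel n)
    (isClosed_of_inter : ∀ S : Set X, (∀ n, IsClosed (S ∩ skel n)) → IsClosed S)
    (cell : ℕ → Type u) (isotropy : ∀ n, cell n → Subgroup G)
    (χ : ∀ n, C((Σ i, OrbitProd (isotropy n i) (CellDisk n)), X))
    (χ_smul : ∀ n, IsGMap G (χ n)) (χ_mem : ∀ n p, χ n p ∈ skel (n + 1))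
    (χ_mem_iff : ∀ n p, χ n p ∈ skel n ↔ p ∈ Set.range (cellsBoundaryInclusion n (isotropy n)))
    (χ_inj : ∀ n p p', χ n p ∉ skel n → χ n p = χ n p' → p = p')
    (mem_skel_or : ∀ n x, x ∈ skel (n + 1) → x ∈ skel n ∨ ∃ p, χ n p = x)
    (isClosed_inter_succ : ∀ n S, IsClosed (S ∩ (skel n : Set X)) → IsClosed (χ n ⁻¹' S) →
      IsClosed (S ∩ (skel (n + 1) : Set X))) :
    GCWComplex G X :=
  have isClosed_skel (n : ℕ) : IsClosed (skel n : Set X) := by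
    induction n with
    | zero =>
      rw [skel_zero]
      exact isClosed_empty
    | succ n ih =>
      have := isClosed_inter_succ n Set.univ (by rwa [Set.univ_inter]) isClosed_univ
      rwa [Set.univ_inter] at this
  have inter (n : ℕ) {S : Set X} (hS : IsClosed ((↑) ⁻¹' S : Set (skel n))) :
      IsClosed (S ∩ (skel n : Set X)) := by
    rw [Set.inter_comm, ← Subtype.image_preimage_coe]
    exact (isClosed_skel n).isClosedEmbedding_subtypeVal.isClosedMap _ hS
  { skel := skel
    skel_zero := skel_zero
    skel_mono := skel_mono
    skel_exhaust := skel_exhaust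
    isClosed_of_skel := fun S hS => isClosed_of_inter S fun n => inter n (hS n)
    cell := cell
    isotropy := isotropy
    attach := fun n => ⟨fun p => ⟨χ n (cellsBoundaryInclusion n _ p), (χ_mem_iff n _).2 ⟨p, rfl⟩⟩,
      ((χ n).continuous.comp (cellsBoundaryInclusion n _).continuous).subtype_mk _⟩
    char := fun n => ⟨fun p => ⟨χ n p, χ_mem n p⟩, (χ n).continuous.subtype_mk _⟩
    isGPushout := fun n => by
      refine IsGluing.isGPushout ⟨fun p => rfl,
        Set.inclusion_injective (skel_mono n.le_succ), ?_, ?_, ?_, ?_⟩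
        (fun g p => Subtype.ext (χ_smul n g (cellsBoundaryInclusion n _ p))) isGMap_cellsBoundaryInclusion (fun g x => rfl)
        (fun g p => Subtype.ext (χ_smul n g p))
      · intro b p h
        have h : (b : X) = χ n p := congrArg Subtype.val h
        obtain ⟨a, rfl⟩ := (χ_mem_iff n p).1 (h ▸ b.2)
        exact ⟨a, Subtype.ext h.symm, rfl⟩
      · intro p p' h
        have h : χ n p = χ n p' := congrArg Subtype.val h
        by_cases hp : χ n p ∈ skel n
        · exact Or.inr ⟨(χ_mem_iff n p).1 hp, (χ_mem_iff n p').1 (h ▸ hp)⟩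
        · exact Or.inl (χ_inj n p p' hp h)
      · rintro ⟨x, hx⟩
        by_cases h : x ∈ skel n
        · exact Or.inl ⟨⟨x, h⟩, rfl⟩
        · obtain ⟨p, rfl⟩ := (mem_skel_or n x hx).resolve_left h
          exact Or.inr ⟨p, fun hp => h ((χ_mem_iff n p).2 hp), rfl⟩
      · intro S h h'
        have e : (↑) ⁻¹' ((↑) '' S : Set X) = S :=
          Set.preimage_image_eq S Subtype.val_injective
        rw [← e]
        refine IsClosed.preimage continuous_subtype_val ?_
        have := isClosed_inter_succ n ((↑) '' S) (inter n ?_) ?_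
        · rwa [Set.inter_eq_left.2 (by rintro _ ⟨x, -, rfl⟩; exact x.2)] at this
        · convert h using 1
          ext x
          refine ⟨fun ⟨y, hy, e⟩ => ?_, fun hx => ⟨_, hx, rfl⟩⟩
          obtain rfl : y = Set.inclusion (skel_mono n.le_succ) x := Subtype.ext e
          exact hy
        · convert h' using 1
          ext x
          refine ⟨fun ⟨y, hy, e⟩ => ?_, fun hx => ⟨_, hx, rfl⟩⟩
          obtain rfl : y = ⟨χ n x, χ_mem n x⟩ := Subtype.ext e
          exact hy }

/-- The one-point `G`-space is a `G`-CW-complex with a single cell. -/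
def point [MulAction G PUnit.{u + 1}] : GCWComplex G PUnit.{u + 1} :=
  ofCharMap (fun n => if n = 0 then ⊥ else ⊤) rfl
    (fun m n h => by
      dsimp only
      split_ifs with h1 h2 <;> first | exact bot_le | exact le_top | omega)
    (fun x => ⟨1, trivial⟩) (fun S _ => isClosed_discrete S)
    (fun n => ULift (PLift (n = 0))) (fun _ _ => ⊤)
    (fun n => ⟨fun _ => PUnit.unit, continuous_const⟩) (fun _ _ _ => rfl) (fun _ _ => trivial)
    (fun n p => by
      obtain ⟨⟨⟨rfl⟩⟩, p⟩ := p
      exact ⟨fun h => h.elim, fun ⟨q, _⟩ => isEmptyElim q.2.2⟩)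
    (fun n p p' _ _ => by
      obtain ⟨⟨⟨rfl⟩⟩, a, d⟩ := p
      obtain ⟨⟨⟨_⟩⟩, a', d'⟩ := p'
      have h1 : a = a' := by
        induction a using QuotientGroup.induction_on
        induction a' using QuotientGroup.induction_on
        exact QuotientGroup.eq.2 trivial
      have h2 : d = d' := Subtype.ext (Subsingleton.elim _ _)
      rw [h1, h2])
    (fun n x _ => by
      rcases eq_or_ne n 0 with rfl | hn
      · exact Or.inr ⟨⟨⟨⟨rfl⟩⟩, OrbitProd.mk ((1 : G) : G ⧸ ⊤) (CellDisk.center 0)⟩, rfl⟩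
      · left
        rw [if_neg hn]
        trivial)
    (fun _ _ _ _ => isClosed_discrete _)

/-- The product of the free orbit `G` with the space underlying a `G`-CW-complex. -/
noncomputable def orbitProd [ContinuousSMul G X] (c : GCWComplex G X) :
    GCWComplex G (OrbitProd (⊥ : Subgroup G) X) :=
  ofCharMap (fun n => ⟨{p | p.2 ∈ c.skel n}, fun _ _ h => h⟩)
    (by
      ext p
      change p.2 ∈ c.skel 0 ↔ _
      rw [c.skel_zero]
      rfl)
    (fun m n h p hp => c.skel_mono h hp) (fun p => c.skel_exhaust p.2)
    (fun S hS => OrbitProd.isClosed_iff.2 fun a => c.isClosed_of_inter fun n =>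
      OrbitProd.isClosed_iff.1 (hS n) a)
    (fun n => Σ i, G ⧸ c.isotropy n i) (fun _ _ => ⊥)
    (fun n => ⟨fun p => OrbitProd.mk p.2.1 (c.charMap n ⟨p.1.1, OrbitProd.mk p.1.2 p.2.2⟩),
      continuous_cells_iff.2 fun i a => (OrbitProd.continuous_mk a).comp
        (continuous_cells_iff.1 (c.charMap n).continuous i.1 i.2)⟩)
    (fun n g p => rfl) (fun n p => c.charMap_mem n _)
    (fun n p => by
      rw [mem_range_cellsBoundaryInclusion]
      exact c.charMap_mem_iff.trans mem_range_cellsBoundaryInclusion)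
    (fun n p p' hp h => by
      obtain ⟨⟨i, b⟩, a, d⟩ := p
      obtain ⟨⟨i', b'⟩, a', d'⟩ := p'
      obtain rfl : a = a' := congrArg Prod.fst h
      have := c.charMap_inj hp (congrArg Prod.snd h)
      obtain rfl : i = i' := congrArg Sigma.fst this
      have := eq_of_heq (Sigma.mk.inj_iff.1 this).2
      obtain rfl : b = b' := congrArg Prod.fst this
      obtain rfl : d = d' := congrArg Prod.snd this
      rfl)
    (fun n p hp => by
      rcases c.mem_skel_or n hp with h | ⟨⟨i, b, d⟩, h⟩
      · exact Or.inl h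
      · exact Or.inr ⟨⟨⟨i, b⟩, OrbitProd.mk p.1 d⟩, Prod.ext rfl h⟩)
    (fun n S h h' => OrbitProd.isClosed_iff.2 fun a => c.isClosed_inter_succ
      (OrbitProd.isClosed_iff.1 h a)
      (isClosed_cells_iff.2 fun i b => isClosed_cells_iff.1 h' ⟨i, b⟩ a))

end GCWComplex

theorem OrbitProd.stabilizer_eq_bot {G : Type*} [Group G] {D : Type*}
    (p : OrbitProd (⊥ : Subgroup G) D) : MulAction.stabilizer G p = ⊥ := by
  obtain ⟨a, d⟩ := p
  induction a using QuotientGroup.induction_on with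
  | H x =>
    rw [eq_bot_iff]
    intro g hg
    have h : ((g * x : G) : G ⧸ (⊥ : Subgroup G)) = x :=
      congrArg (fun q : OrbitProd (⊥ : Subgroup G) D => q.1) (MulAction.mem_stabilizer_iff.1 hg)
    simpa [QuotientGroup.eq] using h

/-- The space underlying a model for `EG` is contractible. -/
theorem IsModelEG.contractibleSpace {G : Type u} [Group G] [TopologicalSpace G]
    [DiscreteTopology G] {X : Type u} [TopologicalSpace X] [MulAction G X] [ContinuousSMul G X]
    (h : IsModelEG G X) : ContractibleSpace X := by
  let one : G ⧸ (⊥ : Subgroup G) := (1 : G)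
  have hx : Nonempty X := by
    let : MulAction G PUnit.{u + 1} :=
      { smul := fun _ x => x, one_smul := fun _ => rfl, mul_smul := fun _ _ _ => rfl }
    have : ContinuousSMul G PUnit.{u + 1} := ⟨continuous_of_const fun _ _ => rfl⟩
    obtain ⟨f, -⟩ := h.universal (OrbitProd (⊥ : Subgroup G) PUnit.{u + 1})
      ⟨GCWComplex.point.orbitProd⟩ fun p => OrbitProd.stabilizer_eq_bot p
    exact ⟨f (OrbitProd.mk one PUnit.unit)⟩
  obtain ⟨x₀⟩ := hx
  obtain ⟨c⟩ := h.isGCW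
  obtain ⟨f, -, hf⟩ := h.universal (OrbitProd (⊥ : Subgroup G) X) ⟨c.orbitProd⟩
    fun p => OrbitProd.stabilizer_eq_bot p
  have key : ∀ τ : C(X, X), ∃ ψ : C(OrbitProd (⊥ : Subgroup G) X, X), IsGMap G ψ ∧
      ∀ x, ψ (OrbitProd.mk one x) = τ x := by
    intro τ
    obtain ⟨ψ, hψ, hψ'⟩ := exists_cells_desc (H := fun _ : Unit => (⊥ : Subgroup G))
      (fun _ => τ) (by rintro - d g hg; rw [Subgroup.mem_bot.1 hg, one_smul])
    refine ⟨⟨fun p => ψ ⟨(), p⟩, ψ.continuous.comp continuous_sigmaMk⟩, fun g p => hψ g ⟨(), p⟩,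
      fun x => ?_⟩
    exact (hψ' () 1 x).trans (one_smul G _)
  obtain ⟨ψ, hψ, hψ'⟩ := key (ContinuousMap.id X)
  obtain ⟨θ, hθ, hθ'⟩ := key (ContinuousMap.const X x₀)
  obtain ⟨F⟩ := hf ψ hψ
  obtain ⟨F'⟩ := hf θ hθ
  have H : ContinuousMap.Homotopic ψ θ := ⟨F.toHomotopy.symm.trans F'.toHomotopy⟩
  have H' := H.comp (ContinuousMap.Homotopic.refl
    ⟨fun x : X => (OrbitProd.mk one x : OrbitProd (⊥ : Subgroup G) X), OrbitProd.continuous_mk one⟩)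
  rw [contractible_iff_id_nullhomotopic]
  refine ⟨x₀, ?_⟩
  convert H' using 1
  · exact ContinuousMap.ext fun x => (hψ' x).symm
  · exact ContinuousMap.ext fun x => (hθ' x).symm

/-! ### Equivariant lifting over the cells of a `G`-CW-complex -/

namespace GCWComplex

variable {G : Type u} [Group G] [TopologicalSpace G] {Y : Type u} [TopologicalSpace Y]
  [MulAction G Y] (c : GCWComplex G Y) {P : Type u} [TopologicalSpace P] [MulAction G P]

/-- The point of the equivariant cell `i` with coordinates `(1, d)`. -/
def basePoint {n : ℕ} (i : c.cell n) (d : CellDisk n) : Y :=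
  c.charMap n ⟨i, OrbitProd.mk ((1 : G) : G ⧸ c.isotropy n i) d⟩

theorem charMap_eq_smul {n : ℕ} (i : c.cell n) (g : G) (d : CellDisk n) :
    c.charMap n ⟨i, OrbitProd.mk (g : G ⧸ c.isotropy n i) d⟩ = g • c.basePoint i d := by
  rw [basePoint, ← charMap_smul, Sigma.smul_mk, OrbitProd.smul_mk]
  congr 3
  simp [MulAction.Quotient.smul_mk]

/-- Maps into `P` can be prescribed on an equivariant cell: the cellwise lifting problem for a
relation `R` between `Y` and `P`. -/
def HasCellLift (R : Y → P → Prop) {n : ℕ} (i : c.cell n) : Prop :=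
  ∀ σ : C(CellSphere n, P), (∀ s, ∀ g ∈ c.isotropy n i, g • σ s = σ s) →
    (∀ s, R (c.basePoint i (cellBoundaryInclusion n s)) (σ s)) →
    ∃ τ : C(CellDisk n, P), (∀ d, ∀ g ∈ c.isotropy n i, g • τ d = τ d) ∧
      (∀ s, τ (cellBoundaryInclusion n s) = σ s) ∧ ∀ d, R (c.basePoint i d) (τ d)

/-- A partial solution of a lifting problem, defined on a skeleton. -/
structure IsPartialLift (R : Y → P → Prop) (A : Set Y) (φ : Y → P) (n : ℕ)
    (Φ : C(c.skel n, P)) : Prop where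
  smul : ∀ (g : G) (x : c.skel n), Φ (g • x) = g • Φ x
  rel : ∀ x : c.skel n, R x (Φ x)
  eq : ∀ x : c.skel n, (x : Y) ∈ A → Φ x = φ x

variable [DiscreteTopology G] [ContinuousSMul G Y] [ContinuousSMul G P]
  {c} {R : Y → P → Prop} {A : Set Y} {J : ∀ n, Set (c.cell n)} {φ : Y → P}

theorem IsPartialLift.exists_succ (hA : IsClosed A)
    (hJ : A = ⋃ (n : ℕ) (i ∈ J n), c.openCell n i) (hR : ∀ (g : G) y p, R y p → R (g • y) (g • p))
    (hφ : ContinuousOn φ A) (hφ_smul : ∀ (g : G), ∀ a ∈ A, φ (g • a) = g • φ a)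
    (hφR : ∀ a ∈ A, R a (φ a)) (hcell : ∀ n (i : c.cell n), i ∉ J n → c.HasCellLift R i) {n : ℕ}
    {Φ : C(c.skel n, P)} (hΦ : c.IsPartialLift R A φ n Φ) :
    ∃ Ψ : C(c.skel (n + 1), P), c.IsPartialLift R A φ (n + 1) Ψ ∧
      ∀ x, Ψ (Set.inclusion (c.skel_mono n.le_succ) x) = Φ x := by
  let q (i : c.cell n) (s : CellSphere n) : Σ i, OrbitProd (c.isotropy n i) (CellSphere n) :=
    ⟨i, OrbitProd.mk ((1 : G) : G ⧸ c.isotropy n i) s⟩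
  have hq : ∀ i s, (c.attach n (q i s) : Y) = c.basePoint i (cellBoundaryInclusion n s) :=
    fun i s => (c.charMap_boundary n (q i s)).symm
  have step : ∀ i, ∃ τ : C(CellDisk n, P), (∀ d, ∀ g ∈ c.isotropy n i, g • τ d = τ d) ∧
      (∀ s, τ (cellBoundaryInclusion n s) = Φ (c.attach n (q i s))) ∧
      (∀ d, R (c.basePoint i d) (τ d)) ∧ (i ∈ J n → ∀ d, τ d = φ (c.basePoint i d)) := by
    intro i
    by_cases hi : i ∈ J n
    · have hmem : ∀ d, c.basePoint i d ∈ A := fun d => c.charMap_mem_subcomplex hA hJ hi _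
      refine ⟨⟨fun d => φ (c.basePoint i d), ?_⟩, ?_, ?_, fun d => hφR _ (hmem d), fun _ d => rfl⟩
      · exact hφ.comp_continuous
          (continuous_cells_iff.1 (c.charMap n).continuous i ((1 : G) : G ⧸ c.isotropy n i)) hmem
      · intro d g hg
        change g • φ _ = φ _
        rw [← hφ_smul g _ (hmem d), basePoint, c.smul_charMap_of_mem hg]
      · intro s
        have := hq i s
        exact ((hΦ.eq _ (this ▸ hmem _)).trans (congrArg φ this)).symm
    · have hc : Continuous fun s => Φ (c.attach n (q i s)) :=
        Φ.continuous.comp (continuous_cells_iff.1 (c.attach n).continuous i _)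
      have hfix : ∀ s, ∀ g ∈ c.isotropy n i,
          g • Φ (c.attach n (q i s)) = Φ (c.attach n (q i s)) := by
        intro s g hg
        rw [← hΦ.smul]
        congr 1
        refine Subtype.ext ?_
        change g • (c.attach n (q i s) : Y) = c.attach n (q i s)
        rw [hq, basePoint, c.smul_charMap_of_mem hg]
      obtain ⟨τ, h1, h2, h3⟩ := hcell n i hi ⟨fun s => Φ (c.attach n (q i s)), hc⟩ hfix
        fun s => hq i s ▸ hΦ.rel _
      exact ⟨τ, h1, h2, h3, fun h => absurd h hi⟩
  choose τ h1 h2 h3 h4 using step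
  obtain ⟨ψ, hψ, hψτ⟩ := exists_cells_desc τ h1
  have compat : ∀ p, Φ (c.attach n p) = ψ (cellsBoundaryInclusion n _ p) := by
    rintro ⟨i, a, s⟩
    induction a using QuotientGroup.induction_on with
    | H g =>
      have e : (⟨i, ((g : G ⧸ c.isotropy n i), s)⟩ :
          Σ i, OrbitProd (c.isotropy n i) (CellSphere n)) = g • q i s := by
        rw [Sigma.smul_mk, OrbitProd.smul_mk]
        simp [MulAction.Quotient.smul_mk, OrbitProd.mk]
      refine (congrArg (fun p => Φ (c.attach n p)) e).trans
        (.trans ?_ (hψτ i g (cellBoundaryInclusion n s)).symm)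
      rw [(c.isGPushout n).top_equivariant, hΦ.smul, h2]
  obtain ⟨Ψ, hΨ, hΨ'⟩ := (c.isGluing n).exists_desc Φ ψ compat
  refine ⟨Ψ, ⟨?_, ?_, ?_⟩, hΨ⟩
  · intro g x
    rcases (c.isGluing n).cover x with ⟨b, rfl⟩ | ⟨p, -, rfl⟩
    · rw [hΨ, ← hΦ.smul, ← hΨ]
      rfl
    · rw [← (c.isGPushout n).bottom_equivariant, hΨ', hΨ', hψ]
  · intro x
    rcases (c.isGluing n).cover x with ⟨b, rfl⟩ | ⟨⟨i, a, d⟩, -, rfl⟩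
    · rw [hΨ]
      exact hΦ.rel b
    · rw [hΨ']
      induction a using QuotientGroup.induction_on with
      | H g =>
        have e := c.charMap_eq_smul i g d
        have e' := hψτ i g d
        change R (c.charMap n ⟨i, OrbitProd.mk (g : G ⧸ c.isotropy n i) d⟩)
          (ψ ⟨i, OrbitProd.mk (g : G ⧸ c.isotropy n i) d⟩)
        rw [e, e']
        exact hR _ _ _ (h3 i d)
  · intro x hx
    by_cases hx' : (x : Y) ∈ c.skel n
    · exact (hΨ ⟨x, hx'⟩).trans (hΦ.eq ⟨x, hx'⟩ hx)
    · rcases (c.isGluing n).cover x with ⟨b, rfl⟩ | ⟨⟨i, a, d⟩, -, rfl⟩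
      · exact absurd b.2 hx'
      · rw [hΨ']
        have hi : i ∈ J n := c.mem_of_charMap_mem_subcomplex hJ hx' hx
        have hmem : c.basePoint i d ∈ A := c.charMap_mem_subcomplex hA hJ hi _
        induction a using QuotientGroup.induction_on with
        | H g =>
          have e := c.charMap_eq_smul i g d
          have e' := hψτ i g d
          change ψ ⟨i, OrbitProd.mk (g : G ⧸ c.isotropy n i) d⟩
            = φ (c.charMap n ⟨i, OrbitProd.mk (g : G ⧸ c.isotropy n i) d⟩)
          rw [e, e', hφ_smul g _ hmem, h4 i hi]

/-- Lifting problems on a `G`-CW-complex relative to a subcomplex can be solved cell by cell. -/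
theorem exists_lift (hA : IsClosed A)
    (hJ : A = ⋃ (n : ℕ) (i ∈ J n), c.openCell n i) (hR : ∀ (g : G) y p, R y p → R (g • y) (g • p))
    (hφ : ContinuousOn φ A) (hφ_smul : ∀ (g : G), ∀ a ∈ A, φ (g • a) = g • φ a)
    (hφR : ∀ a ∈ A, R a (φ a)) (hcell : ∀ n (i : c.cell n), i ∉ J n → c.HasCellLift R i) :
    ∃ Φ : C(Y, P), IsGMap G Φ ∧ (∀ y, R y (Φ y)) ∧ ∀ a ∈ A, Φ a = φ a := by
  have zero : IsEmpty (c.skel 0) := ⟨fun x => by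
    have h : (x : Y) ∈ (⊥ : SubMulAction G Y) := c.skel_zero ▸ x.2
    exact h⟩
  choose next hnext hnext' using fun n (Φ : {Φ // c.IsPartialLift R A φ n Φ}) =>
    Φ.2.exists_succ hA hJ hR hφ hφ_smul hφR hcell
  let seq (n : ℕ) : {Φ // c.IsPartialLift R A φ n Φ} := Nat.rec
    ⟨⟨fun x => isEmptyElim x, continuous_of_const fun x => isEmptyElim x⟩,
      fun _ x => isEmptyElim x, fun x => isEmptyElim x, fun x => isEmptyElim x⟩
    (fun n Φ => ⟨next n Φ, hnext n Φ⟩) n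
  have hseq : ∀ n m (h : n ≤ m) x, (seq m).1 (Set.inclusion (c.skel_mono h) x) = (seq n).1 x := by
    intro n m h x
    induction m, h using Nat.le_induction with
    | base => rfl
    | succ m h ih => exact (hnext' m (seq m) _).trans ih
  have hseq' : ∀ n m y (hn : y ∈ c.skel n) (hm : y ∈ c.skel m),
      (seq n).1 ⟨y, hn⟩ = (seq m).1 ⟨y, hm⟩ := by
    intro n m y hn hm
    rcases le_total n m with h | h
    · exact (hseq n m h ⟨y, hn⟩).symm
    · exact hseq m n h ⟨y, hm⟩
  choose N hN using c.skel_exhaust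
  let Φ (y : Y) : P := (seq (N y)).1 ⟨y, hN y⟩
  have hΦ : ∀ n y (hy : y ∈ c.skel n), Φ y = (seq n).1 ⟨y, hy⟩ := fun n y hy => hseq' _ _ _ _ _
  refine ⟨⟨Φ, continuous_iff_isClosed.2 fun S hS => c.isClosed_of_skel _ fun n => ?_⟩, ?_, ?_, ?_⟩
  · rw [← Set.preimage_comp, show Φ ∘ ((↑) : c.skel n → Y) = (seq n).1 from
      funext fun x => hΦ n x x.2]
    exact hS.preimage (seq n).1.continuous
  · intro g y
    exact (hΦ (N y) (g • y) ((c.skel (N y)).smul_mem g (hN y))).trans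
      ((seq (N y)).2.smul g ⟨y, hN y⟩)
  · intro y
    exact (seq (N y)).2.rel ⟨y, hN y⟩
  · intro a ha
    exact (seq (N a)).2.eq ⟨a, hN a⟩ ha

end GCWComplex

/-! ### Extension problems on disks -/

open scoped unitInterval

/-- A map from the unit sphere to a contractible space extends to the closed unit ball. -/
theorem exists_extension_closedBall {V Z : Type*} [NormedAddCommGroup V] [NormedSpace ℝ V]
    [ProperSpace V] [TopologicalSpace Z] [ContractibleSpace Z]
    (ρ : C(Metric.sphere (0 : V) 1, Z)) :
    ∃ τ : C(Metric.closedBall (0 : V) 1, Z), ∀ s, τ (Set.inclusion Metric.sphere_subset_closedBall s)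
      = ρ s := by
  obtain ⟨z, hz⟩ := id_nullhomotopic Z
  obtain ⟨F⟩ := hz.comp (ContinuousMap.Homotopic.refl ρ)
  have : CompactSpace (Metric.sphere (0 : V) 1) :=
    isCompact_iff_compactSpace.1 (isCompact_sphere 0 1)
  let q : (I × Metric.sphere (0 : V) 1) ⊕ Unit → Metric.closedBall (0 : V) 1 :=
    Sum.elim (fun p => ⟨(p.1 : ℝ) • (p.2 : V), by
      rw [mem_closedBall_zero_iff, norm_smul, mem_sphere_zero_iff_norm.1 p.2.2, mul_one,
        Real.norm_of_nonneg p.1.2.1]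
      exact p.1.2.2⟩) fun _ => ⟨0, by simp⟩
  have hq : Continuous q := by
    refine continuous_sum_dom.2 ⟨?_, continuous_const⟩
    exact Continuous.subtype_mk (by fun_prop) _
  have hq_surj : Function.Surjective q := by
    rintro ⟨v, hv⟩
    rw [mem_closedBall_zero_iff] at hv
    by_cases h0 : v = 0
    · exact ⟨Sum.inr (), Subtype.ext h0.symm⟩
    · refine ⟨Sum.inl (⟨‖v‖, norm_nonneg v, hv⟩, ⟨‖v‖⁻¹ • v, ?_⟩), Subtype.ext ?_⟩
      · rw [mem_sphere_zero_iff_norm, norm_smul, norm_inv, norm_norm,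
          inv_mul_cancel₀ (norm_ne_zero_iff.2 h0)]
      · exact smul_inv_smul₀ (norm_ne_zero_iff.2 h0) v
  have hquot : IsQuotientMap (⟨q, hq⟩ : C(_, _)) := hq.isClosedMap.isQuotientMap hq hq_surj
  let ψ : C((I × Metric.sphere (0 : V) 1) ⊕ Unit, Z) :=
    ⟨Sum.elim (fun p => F (unitInterval.symm p.1, p.2)) fun _ => z, by
      refine continuous_sum_dom.2 ⟨?_, continuous_const⟩
      change Continuous fun p : I × Metric.sphere (0 : V) 1 => F (unitInterval.symm p.1, p.2)
      fun_prop⟩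
  have norm_eq : ∀ p : I × Metric.sphere (0 : V) 1, ‖(p.1 : ℝ) • (p.2 : V)‖ = p.1 := fun p => by
    rw [norm_smul, mem_sphere_zero_iff_norm.1 p.2.2, mul_one, Real.norm_of_nonneg p.1.2.1]
  have hψ0 : ∀ p : I × Metric.sphere (0 : V) 1, (p.1 : ℝ) = 0 → ψ (Sum.inl p) = z := by
    rintro ⟨t, s⟩ h
    obtain rfl : t = 0 := Subtype.ext h
    change F (unitInterval.symm 0, s) = z
    rw [unitInterval.symm_zero, F.apply_one]
    rfl
  have hfib : ∀ a b, q a = q b → ψ a = ψ b := by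
    rintro (p | ⟨⟩) (p' | ⟨⟩) h
    · have h : (p.1 : ℝ) • (p.2 : V) = (p'.1 : ℝ) • (p'.2 : V) := congrArg Subtype.val h
      have h1 : (p.1 : ℝ) = p'.1 := 
        (norm_eq p).symm.trans ((congrArg norm h).trans (norm_eq p'))
      by_cases h0 : (p.1 : ℝ) = 0
      · rw [hψ0 p h0, hψ0 p' (h1 ▸ h0)]
      · have h2 : p.2 = p'.2 := Subtype.ext (by
          rw [← h1] at h
          exact smul_right_injective V h0 h)
        rw [show p = p' from Prod.ext (Subtype.ext h1) h2]
    · have h : (p.1 : ℝ) • (p.2 : V) = 0 := congrArg Subtype.val h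
      exact hψ0 p (by rw [← norm_eq, h, norm_zero])
    · have h : 0 = (p'.1 : ℝ) • (p'.2 : V) := congrArg Subtype.val h
      exact (hψ0 p' (by rw [← norm_eq, ← h, norm_zero])).symm
    · rfl
  refine ⟨hquot.lift ψ hfib, fun s => ?_⟩
  have e : Set.inclusion Metric.sphere_subset_closedBall s = q (Sum.inl (1, s)) :=
    Subtype.ext (one_smul ℝ (s : V)).symm
  rw [e]
  refine (DFunLike.congr_fun (hquot.lift_comp ψ hfib) (Sum.inl (1, s))).trans ?_
  change F (unitInterval.symm 1, s) = ρ s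
  rw [unitInterval.symm_one, F.apply_zero]
  rfl

/-- The homotopy extension property of the pair `(D^n, S^{n-1})`. -/
theorem exists_homotopy_extension_cellDisk {n : ℕ} {Z : Type*} [TopologicalSpace Z]
    (β : C(CellDisk n, Z)) (ρ : C(CellSphere n × I, Z))
    (h : ∀ s, ρ (s, 0) = β (cellBoundaryInclusion n s)) :
    ∃ τ : C(CellDisk n × I, Z), (∀ s t, τ (cellBoundaryInclusion n s, t) = ρ (s, t)) ∧
      ∀ d, τ (d, 0) = β d := by
  let V := EuclideanSpace ℝ (Fin n)
  let r (p : CellDisk n × I) : ℝ := (1 + (p.2 : ℝ)) * ‖(p.1 : V)‖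
  have hr : Continuous r := by fun_prop
  have hs : ∀ x : V, x ≠ 0 → ‖x‖⁻¹ • x ∈ Metric.sphere (0 : V) 1 := fun x hx => by
    rw [mem_sphere_zero_iff_norm, norm_smul, norm_inv, norm_norm,
      inv_mul_cancel₀ (norm_ne_zero_iff.2 hx)]
  have hne : ∀ p, 1 ≤ r p → (p.1 : V) ≠ 0 := fun p hp h0 => by
    simp only [r, h0, norm_zero, mul_zero] at hp
    linarith
  have hball : ∀ p, r p ≤ 1 → (1 + (p.2 : ℝ)) • (p.1 : V) ∈ Metric.closedBall (0 : V) 1 := by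
    intro p hp
    rwa [mem_closedBall_zero_iff, norm_smul, Real.norm_of_nonneg (by linarith [p.2.2.1])]
  let f' (p : CellDisk n × I) : Z := if hp : r p ≤ 1 then β ⟨_, hball p hp⟩ else β p.1
  let g' (p : CellDisk n × I) : Z := if hp : 1 ≤ r p then
    ρ (⟨_, hs p.1 (hne p hp)⟩, Set.projIcc 0 1 zero_le_one (r p - 1)) else β p.1
  have hf' : ContinuousOn f' {p | r p ≤ 1} := by
    rw [continuousOn_iff_continuous_domRestrict]
    have e : Set.domRestrict {p | r p ≤ 1} f' = fun p => β ⟨_, hball p.1 p.2⟩ :=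
      funext fun p => dif_pos p.2
    rw [e]
    exact β.continuous.comp (Continuous.subtype_mk (by fun_prop) _)
  have hg' : ContinuousOn g' {p | 1 ≤ r p} := by
    rw [continuousOn_iff_continuous_domRestrict]
    have e : Set.domRestrict {p | 1 ≤ r p} g' = fun p => ρ (⟨_, hs p.1.1 (hne p.1 p.2)⟩,
      Set.projIcc 0 1 zero_le_one (r p.1 - 1)) := funext fun p => dif_pos p.2
    rw [e]
    refine ρ.continuous.comp (Continuous.prodMk (Continuous.subtype_mk ?_ _) ?_)
    · have hx : Continuous fun p : {p | 1 ≤ r p} => (p.1.1 : V) := by fun_prop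
      exact (hx.norm.inv₀ fun p => norm_ne_zero_iff.2 (hne p.1 p.2)).smul hx
    · exact continuous_projIcc.comp (by fun_prop)
  have hfg : ∀ p, r p = 1 → f' p = g' p := by
    intro p hp
    have e : f' p = β ⟨_, hball p hp.le⟩ := dif_pos hp.le
    have e' : g' p = ρ (⟨_, hs p.1 (hne p hp.ge)⟩, Set.projIcc 0 1 zero_le_one (r p - 1)) :=
      dif_pos hp.ge
    have e₀ : Set.projIcc (0 : ℝ) 1 zero_le_one (r p - 1) = 0 := by
      rw [hp, sub_self, Set.projIcc_left]
      rfl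
    rw [e, e', e₀]
    refine .trans ?_ (h _).symm
    congr 1
    refine Subtype.ext ?_
    change (1 + (p.2 : ℝ)) • (p.1 : V) = ‖(p.1 : V)‖⁻¹ • (p.1 : V)
    rw [eq_inv_of_mul_eq_one_left hp]
  refine ⟨⟨fun p => if r p ≤ 1 then f' p else g' p, ?_⟩, ?_, ?_⟩
  · exact continuous_if_le hr continuous_const hf' hg' hfg
  · intro s t
    have hs1 : ‖(s : V)‖ = 1 := mem_sphere_zero_iff_norm.1 s.2
    have hrp : r (cellBoundaryInclusion n s, t) = 1 + t := by
      change (1 + (t : ℝ)) * ‖(s : V)‖ = _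
      rw [hs1, mul_one]
    have h1 : 1 ≤ r (cellBoundaryInclusion n s, t) := by
      rw [hrp]
      linarith [t.2.1]
    have e : (if r (cellBoundaryInclusion n s, t) ≤ 1 then f' (cellBoundaryInclusion n s, t)
        else g' (cellBoundaryInclusion n s, t)) = g' (cellBoundaryInclusion n s, t) := by
      split_ifs with h2
      · exact hfg _ (le_antisymm h2 h1)
      · rfl
    refine e.trans ((dif_pos h1).trans ?_)
    congr 2
    · refine Subtype.ext ?_
      change ‖(s : V)‖⁻¹ • (s : V) = s
      rw [hs1, inv_one, one_smul]
    · rw [hrp, add_sub_cancel_left, Set.projIcc_val]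
  · intro d
    have h1 : r (d, 0) ≤ 1 := by
      have := mem_closedBall_zero_iff.1 d.2
      simpa [r] using this
    refine (if_pos h1).trans ((dif_pos h1).trans ?_)
    congr 1
    refine Subtype.ext ?_
    simp

/-- In a contractible space, a homotopy on the boundary of a disk between the restrictions of two
maps extends to a homotopy between the maps. -/
theorem exists_homotopy_of_contractibleSpace {n : ℕ} {Z : Type*} [TopologicalSpace Z]
    [ContractibleSpace Z] (β₀ β₁ : C(CellDisk n, Z)) (ρ : C(CellSphere n × I, Z))
    (h₀ : ∀ s, ρ (s, 0) = β₀ (cellBoundaryInclusion n s))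
    (h₁ : ∀ s, ρ (s, 1) = β₁ (cellBoundaryInclusion n s)) :
    ∃ τ : C(CellDisk n × I, Z), (∀ s t, τ (cellBoundaryInclusion n s, t) = ρ (s, t)) ∧
      (∀ d, τ (d, 0) = β₀ d) ∧ ∀ d, τ (d, 1) = β₁ d := by
  classical
  let V := EuclideanSpace ℝ (Fin n)
  let S := Metric.sphere (0 : V × ℝ) 1
  have hnorm : ∀ p : S, max ‖p.1.1‖ ‖p.1.2‖ = 1 := fun p => mem_sphere_zero_iff_norm.1 p.2
  have hle : ∀ p : S, p.1.1 ∈ Metric.closedBall (0 : V) 1 := fun p =>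
    mem_closedBall_zero_iff.2 ((le_max_left _ _).trans (hnorm p).le)
  have hI : ∀ t : I, (2 * (t : ℝ) - 1 + 1) / 2 = t := fun t => by ring
  let b (p : S) : Z := if h : p.1.1 ∈ Metric.sphere (0 : V) 1 then
      ρ (⟨p.1.1, h⟩, Set.projIcc 0 1 zero_le_one ((p.1.2 + 1) / 2))
    else if p.1.2 ≤ 0 then β₀ ⟨_, hle p⟩ else β₁ ⟨_, hle p⟩
  have b₀ : ∀ p : S, p.1.2 = -1 → b p = β₀ ⟨_, hle p⟩ := by
    intro p hp
    by_cases h : p.1.1 ∈ Metric.sphere (0 : V) 1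
    · refine (dif_pos h).trans ?_
      rw [hp, neg_add_cancel, zero_div, Set.projIcc_left]
      exact h₀ _
    · exact (dif_neg h).trans (if_pos (by rw [hp]; norm_num))
  have b₁ : ∀ p : S, p.1.2 = 1 → b p = β₁ ⟨_, hle p⟩ := by
    intro p hp
    by_cases h : p.1.1 ∈ Metric.sphere (0 : V) 1
    · refine (dif_pos h).trans ?_
      rw [hp, one_add_one_eq_two, div_self two_ne_zero, Set.projIcc_right]
      exact h₁ _
    · exact (dif_neg h).trans (if_neg (by rw [hp]; norm_num))
  have hb : Continuous b := by
    have c1 : IsClosed {p : S | p.1.1 ∈ Metric.sphere (0 : V) 1} :=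
      Metric.isClosed_sphere.preimage (by fun_prop)
    have c2 : IsClosed {p : S | p.1.2 = -1} := isClosed_eq (by fun_prop) continuous_const
    have c3 : IsClosed {p : S | p.1.2 = 1} := isClosed_eq (by fun_prop) continuous_const
    have k1 : ContinuousOn b {p : S | p.1.1 ∈ Metric.sphere (0 : V) 1} := by
      rw [continuousOn_iff_continuous_domRestrict]
      have e : Set.domRestrict {p : S | p.1.1 ∈ Metric.sphere (0 : V) 1} b = fun p =>
          ρ (⟨p.1.1.1, p.2⟩, Set.projIcc 0 1 zero_le_one ((p.1.1.2 + 1) / 2)) :=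
        funext fun p => dif_pos p.2
      rw [e]
      exact ρ.continuous.comp (Continuous.prodMk (Continuous.subtype_mk (by fun_prop) _)
        (continuous_projIcc.comp (by fun_prop)))
    have k2 : ContinuousOn b {p : S | p.1.2 = -1} :=
      ContinuousOn.congr (f := fun p : S => β₀ ⟨_, hle p⟩)
        (β₀.continuous.comp (Continuous.subtype_mk (by fun_prop) _)).continuousOn fun p hp =>
          b₀ p hp
    have k3 : ContinuousOn b {p : S | p.1.2 = 1} :=
      ContinuousOn.congr (f := fun p : S => β₁ ⟨_, hle p⟩)
        (β₁.continuous.comp (Continuous.subtype_mk (by fun_prop) _)).continuousOn fun p hp =>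
          b₁ p hp
    rw [← continuousOn_univ]
    refine ((k1.union_of_isClosed k2 c1 c2).union_of_isClosed k3 (c1.union c2) c3).mono ?_
    intro p _
    rcases max_choice ‖p.1.1‖ ‖p.1.2‖ with h | h
    · exact Or.inl (Or.inl (mem_sphere_zero_iff_norm.2 (h.symm.trans (hnorm p))))
    · rcases (abs_eq zero_le_one).1 (h.symm.trans (hnorm p)) with h | h
      · exact Or.inr h
      · exact Or.inl (Or.inr h)
  obtain ⟨τ, hτ⟩ := exists_extension_closedBall (V := V × ℝ) ⟨b, hb⟩
  have hmem : ∀ p : CellDisk n × I,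
      ((p.1 : V), 2 * (p.2 : ℝ) - 1) ∈ Metric.closedBall (0 : V × ℝ) 1 := by
    intro p
    rw [mem_closedBall_zero_iff]
    refine max_le (mem_closedBall_zero_iff.1 p.1.2) (abs_le.2 ⟨?_, ?_⟩)
    · have := p.2.2.1
      simp only
      linarith
    · have := p.2.2.2
      simp only
      linarith
  refine ⟨⟨fun p => τ ⟨_, hmem p⟩, τ.continuous.comp (Continuous.subtype_mk (by fun_prop) _)⟩,
    ?_, ?_, ?_⟩
  · intro s t
    have hs : ‖(s : V)‖ = 1 := mem_sphere_zero_iff_norm.1 s.2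
    have h2 : |2 * (t : ℝ) - 1| ≤ 1 := abs_le.2 ⟨by linarith [t.2.1], by linarith [t.2.2]⟩
    have hS : ((s : V), 2 * (t : ℝ) - 1) ∈ S := mem_sphere_zero_iff_norm.2 <| by
      change max ‖(s : V)‖ |2 * (t : ℝ) - 1| = 1
      rw [hs, max_eq_left h2]
    refine (hτ ⟨_, hS⟩).trans ((dif_pos s.2).trans ?_)
    simp only [hI, Set.projIcc_val]
  · intro d
    have hS : ((d : V), 2 * ((0 : I) : ℝ) - 1) ∈ S := mem_sphere_zero_iff_norm.2 <| by
      change max ‖(d : V)‖ |2 * ((0 : I) : ℝ) - 1| = 1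
      have : |2 * ((0 : I) : ℝ) - 1| = 1 := by norm_num
      rw [this, max_eq_right (mem_closedBall_zero_iff.1 d.2)]
    exact (hτ ⟨_, hS⟩).trans (b₀ ⟨_, hS⟩ (by norm_num))
  · intro d
    have hS : ((d : V), 2 * ((1 : I) : ℝ) - 1) ∈ S := mem_sphere_zero_iff_norm.2 <| by
      change max ‖(d : V)‖ |2 * ((1 : I) : ℝ) - 1| = 1
      have : |2 * ((1 : I) : ℝ) - 1| = 1 := by norm_num
      rw [this, max_eq_right (mem_closedBall_zero_iff.1 d.2)]
    exact (hτ ⟨_, hS⟩).trans (b₁ ⟨_, hS⟩ (by norm_num))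

/-! ### Maps from `G`-CW-complexes to spaces with contractible fixed point sets -/

namespace GCWComplex

theorem map_basePoint_mem_fixedPoints {G : Type u} [Group G] [TopologicalSpace G] {Y X : Type u}
    [TopologicalSpace Y] [MulAction G Y] [TopologicalSpace X] [MulAction G X]
    (c : GCWComplex G Y) {f : C(Y, X)} (hf : IsGMap G f) {n : ℕ} (i : c.cell n)
    (d : CellDisk n) : f (c.basePoint i d) ∈ MulAction.fixedPoints (c.isotropy n i) X := fun g => by
  change (g : G) • f _ = f _
  rw [← hf, basePoint, c.smul_charMap_of_mem g.2]

section Universal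

variable {G : Type u} [Group G] [TopologicalSpace G] [DiscreteTopology G] {Y X : Type u}
  [TopologicalSpace Y] [MulAction G Y] [ContinuousSMul G Y] [TopologicalSpace X] [MulAction G X]
  [ContinuousSMul G X] (c : GCWComplex G Y)

theorem exists_lift_of_hasCellLift {P : Type u} [TopologicalSpace P] [MulAction G P]
    [ContinuousSMul G P] [Nonempty P] {R : Y → P → Prop}
    (hR : ∀ (g : G) y p, R y p → R (g • y) (g • p))
    (hcell : ∀ n (i : c.cell n), c.HasCellLift R i) :
    ∃ Φ : C(Y, P), IsGMap G Φ ∧ ∀ y, R y (Φ y) := by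
  obtain ⟨Φ, h1, h2, -⟩ := exists_lift (c := c) (A := ∅) (J := fun _ => ∅)
    (φ := fun _ => Classical.arbitrary P) isClosed_empty (by simp) hR (continuousOn_empty _)
    (fun _ _ h => h.elim) (fun _ h => h.elim) (fun n i _ => hcell n i)
  exact ⟨Φ, h1, h2⟩

/-- Existence and uniqueness up to homotopy of `G`-maps to a `G`-space whose fixed point sets are
contractible. -/
theorem exists_gMap_unique_upto_homotopy [Nonempty X]
    (hX : ∀ n i, ContractibleSpace (MulAction.fixedPoints (c.isotropy n i) X)) :
    ∃ f : C(Y, X), IsGMap G f ∧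
      ∀ f' : C(Y, X), IsGMap G f' → ContinuousMap.HomotopicWith f f' (IsGMap G) := by
  have hex : ∃ f : C(Y, X), IsGMap G f ∧ ∀ y : Y, True := by
    refine c.exists_lift_of_hasCellLift (R := fun _ _ => True) (fun _ _ _ _ => trivial) fun n i ρ hρ _ => ?_
    have := hX n i
    obtain ⟨τ, hτ⟩ := exists_extension_closedBall (V := EuclideanSpace ℝ (Fin n))
      (Z := MulAction.fixedPoints (c.isotropy n i) X)
      ⟨fun s => ⟨ρ s, fun g => hρ s g g.2⟩, ρ.continuous.subtype_mk _⟩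
    exact ⟨⟨fun d => τ d, continuous_subtype_val.comp τ.continuous⟩,
      fun d g hg => (τ d).2 ⟨g, hg⟩, fun s => congrArg Subtype.val (hτ s), fun _ => trivial⟩
  obtain ⟨f, hf, -⟩ := hex
  refine ⟨f, hf, fun f' hf' => ?_⟩
  have : Nonempty C(I, X) := ⟨ContinuousMap.const I (Classical.arbitrary X)⟩
  obtain ⟨Φ, hΦ, hΦR⟩ := c.exists_lift_of_hasCellLift (P := C(I, X))
    (R := fun y γ => γ 0 = f y ∧ γ 1 = f' y) (fun g y γ h => by
      rw [hf, hf', ← h.1, ← h.2]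
      exact ⟨rfl, rfl⟩) fun n i ρ hρ hρR => by
    have := hX n i
    have hb : Continuous fun d => c.basePoint i d :=
      continuous_cells_iff.1 (c.charMap n).continuous i ((1 : G) : G ⧸ c.isotropy n i)
    obtain ⟨τ, h1, h2, h3⟩ := exists_homotopy_of_contractibleSpace (n := n)
      (Z := MulAction.fixedPoints (c.isotropy n i) X)
      ⟨fun d => ⟨f (c.basePoint i d), c.map_basePoint_mem_fixedPoints hf i d⟩,
        (f.continuous.comp hb).subtype_mk _⟩
      ⟨fun d => ⟨f' (c.basePoint i d), c.map_basePoint_mem_fixedPoints hf' i d⟩,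
        (f'.continuous.comp hb).subtype_mk _⟩
      ⟨fun p => ⟨ρ p.1 p.2, fun g => DFunLike.congr_fun (hρ p.1 g g.2) p.2⟩,
        (ContinuousMap.uncurry ρ).continuous.subtype_mk _⟩
      (fun s => Subtype.ext (hρR s).1) (fun s => Subtype.ext (hρR s).2)
    refine ⟨ContinuousMap.curry ⟨fun p => (τ p : X), continuous_subtype_val.comp τ.continuous⟩,
      fun d g hg => ContinuousMap.ext fun t => (τ (d, t)).2 ⟨g, hg⟩,
      fun s => ContinuousMap.ext fun t => congrArg Subtype.val (h1 s t),
      fun d => ⟨congrArg Subtype.val (h2 d), congrArg Subtype.val (h3 d)⟩⟩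
  exact ⟨{
    toFun := fun p => Φ p.2 p.1
    continuous_toFun := (ContinuousMap.uncurry Φ).continuous.comp continuous_swap
    map_zero_left := fun y => (hΦR y).1
    map_one_left := fun y => (hΦR y).2
    prop' := fun t g y => DFunLike.congr_fun (hΦ g y) t }⟩

end Universal

end GCWComplex

/-! ### The non-equivariant homotopy extension property -/

/-- The coinduced `G`-space of maps from `G` to a space `W`, on which `G` acts by right
translation. -/
def Coinduced (G W : Type*) : Type _ := G → W

namespace Coinduced

variable {G W : Type*} [Group G] [TopologicalSpace W]

instance : TopologicalSpace (Coinduced G W) := inferInstanceAs (TopologicalSpace (G → W))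

instance : MulAction G (Coinduced G W) where
  smul g w := fun x => w (x * g)
  one_smul w := funext fun x => congrArg w (mul_one x)
  mul_smul g g' w := funext fun x => congrArg w (mul_assoc x g g').symm

instance [TopologicalSpace G] [DiscreteTopology G] : ContinuousSMul G (Coinduced G W) :=
  have : ContinuousConstSMul G (Coinduced G W) :=
    ⟨fun g => continuous_pi fun x => continuous_apply (x * g)⟩
  continuousSMul_of_discreteTopology

end Coinduced

/-- A free `G`-CW-complex has the non-equivariant homotopy extension property with respect to
its subcomplexes. -/
theorem GCWComplex.exists_homotopy_extension {G : Type u} [Group G] [TopologicalSpace G]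
    [DiscreteTopology G] {Y Z : Type u} [TopologicalSpace Y] [MulAction G Y] [ContinuousSMul G Y]
    [TopologicalSpace Z] (c : GCWComplex G Y) (hfree : ∀ y : Y, MulAction.stabilizer G y = ⊥)
    {A : Set Y} (hA : c.IsSubcomplex A) (hAG : ∀ (g : G), ∀ a ∈ A, g • a ∈ A) (h : C(Y, Z))
    (φ : Y → C(I, Z)) (hφ : ContinuousOn φ A) (hφ₀ : ∀ a ∈ A, φ a 0 = h a) :
    ∃ Φ : C(Y, C(I, Z)), (∀ y, Φ y 0 = h y) ∧ ∀ a ∈ A, Φ a = φ a := by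
  obtain ⟨hA, J, hJ⟩ := hA
  have hφ' : ContinuousOn (Y := Coinduced G C(I, Z)) (fun y g => φ (g • y)) A :=
    continuousOn_pi.2 fun g => hφ.comp (continuous_const_smul g).continuousOn (hAG g)
  obtain ⟨Φ, -, hΦ, hΦA⟩ := exists_lift (c := c) (P := Coinduced G C(I, Z))
    (R := fun y w => ∀ g : G, w g 0 = h (g • y)) hA hJ
    (fun g y w hw x => (hw (x * g)).trans (by rw [mul_smul]))
    hφ'
    (fun g a _ => funext fun x => congrArg φ (mul_smul x g a).symm)
    (fun a ha g => hφ₀ _ (hAG g a ha)) fun n i _ ρ _ hρ => by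
      have hb : Continuous fun d => c.basePoint i d :=
        continuous_cells_iff.1 (c.charMap n).continuous i ((1 : G) : G ⧸ c.isotropy n i)
      have step (g : G) := exists_homotopy_extension_cellDisk (n := n)
        ⟨fun d => h (g • c.basePoint i d), h.continuous.comp (hb.const_smul g)⟩
        (ContinuousMap.uncurry ⟨fun s => ρ s g, (continuous_apply g).comp ρ.continuous⟩)
        fun s => hρ s g
      choose τ h1 h2 using step
      refine ⟨⟨fun d g => ContinuousMap.curry (τ g) d,
        continuous_pi fun g => (ContinuousMap.curry (τ g)).continuous⟩, ?_,
        fun s => funext fun g => ContinuousMap.ext fun t => h1 g s t, fun d g => h2 g d⟩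
      intro d g hg
      rw [← c.stabilizer_center, hfree, Subgroup.mem_bot] at hg
      rw [hg, one_smul]
  refine ⟨⟨fun y => Φ y 1, (continuous_apply (1 : G)).comp Φ.continuous⟩,
    fun y => (hΦ y 1).trans (by rw [one_smul]), fun a ha => ?_⟩
  exact (congrFun (hΦA a ha) 1).trans (congrArg φ (one_smul G a))

/-! ### Collapsing the induced spaces -/

namespace InducedSpace

variable {G : Type*} [Group G] [TopologicalSpace G] (M : Subgroup G) (E : Type*)
  [TopologicalSpace E] [MulAction M E]

/-- The class of a pair. -/
def mk (p : G × E) : InducedSpace M E := Quotient.mk (inducedSetoid M E) p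

theorem continuous_mk : Continuous (mk M E) := continuous_quotient_mk'

/-- The induced space of a contractible space contracts onto a section of the collapse map, along
its fibres. -/
theorem exists_fiberwise_contraction [DiscreteTopology G] [ContinuousSMul M E]
    [ContractibleSpace E] :
    ∃ (H : C(InducedSpace M E, C(I, InducedSpace M E))) (q : G ⧸ M → InducedSpace M E),
      (∀ a, H a 0 = a) ∧ (∀ a t, collapse M E (H a t) = collapse M E a) ∧
      (∀ a, H a 1 = q (collapse M E a)) ∧ ∀ s, collapse M E (q s) = s := by
  obtain ⟨e₀, ⟨F⟩⟩ := id_nullhomotopic E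
  let r (g : G) : M := ⟨(g : G ⧸ M).out⁻¹ * g, QuotientGroup.eq.1 (Quotient.out_eq _)⟩
  let H₀ (p : G × E) : C(I, InducedSpace M E) :=
    ⟨fun t => mk M E ((p.1 : G ⧸ M).out, F (t, r p.1 • p.2)),
      (continuous_mk M E).comp (by fun_prop)⟩
  have hH₀ : Continuous H₀ := continuous_prod_of_discrete_left.2 fun g => by
    have : Continuous fun p : E × I => mk M E ((g : G ⧸ M).out, F (p.2, r g • p.1)) :=
      (continuous_mk M E).comp (by fun_prop)
    exact (ContinuousMap.curry ⟨_, this⟩).continuous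
  have hwd : ∀ p p', (inducedSetoid M E).r p p' → H₀ p = H₀ p' := by
    rintro ⟨g, e⟩ ⟨g', e'⟩ ⟨m, h1, h2⟩
    dsimp only at h1 h2
    subst h1 h2
    have h3 : ((g' * m : G) : G ⧸ M) = g' := QuotientGroup.mk_mul_of_mem g' m.2
    ext t
    have h4 : r (g' * m) = r g' * m := Subtype.ext (by simp [r, mul_assoc])
    change mk M E (((g' * m : G) : G ⧸ M).out, F (t, r (g' * m) • e))
      = mk M E ((g' : G ⧸ M).out, F (t, r g' • m • e))
    rw [h3, h4, mul_smul]
  refine ⟨⟨Quotient.lift H₀ hwd, hH₀.quotient_lift hwd⟩, fun s => mk M E (s.out, e₀), ?_, ?_, ?_,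
    fun s => Quotient.out_eq s⟩
  · rintro ⟨g, e⟩
    change mk M E ((g : G ⧸ M).out, F (0, r g • e)) = mk M E (g, e)
    rw [F.apply_zero]
    exact (Quotient.sound (s := inducedSetoid M E) ⟨r g, by simp [r], rfl⟩).symm
  · rintro ⟨g, e⟩ t
    exact Quotient.out_eq (g : G ⧸ M)
  · rintro ⟨g, e⟩
    change mk M E ((g : G ⧸ M).out, F (1, r g • e)) = mk M E ((g : G ⧸ M).out, e₀)
    rw [F.apply_one]
    rfl

end InducedSpace

theorem exists_fiberwise_contraction_collapseMaps {G : Type*} [Group G] [TopologicalSpace G]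
    [DiscreteTopology G] {ι : Type*} (M : ι → Subgroup G) (E : ι → Type*)
    [∀ i, TopologicalSpace (E i)] [∀ i, MulAction (M i) (E i)] [∀ i, ContinuousSMul (M i) (E i)]
    [∀ i, ContractibleSpace (E i)] :
    ∃ (H : C((Σ i, InducedSpace (M i) (E i)), C(I, Σ i, InducedSpace (M i) (E i))))
      (q : (Σ i, G ⧸ M i) → Σ i, InducedSpace (M i) (E i)),
      (∀ a, H a 0 = a) ∧ (∀ a t, collapseMaps M E (H a t) = collapseMaps M E a) ∧
      (∀ a, H a 1 = q (collapseMaps M E a)) ∧ ∀ s, collapseMaps M E (q s) = s := by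
  choose H q h0 h1 h2 h3 using fun i => InducedSpace.exists_fiberwise_contraction (M i) (E i)
  let inc (i : ι) : C(InducedSpace (M i) (E i), Σ i, InducedSpace (M i) (E i)) :=
    ⟨fun a => ⟨i, a⟩, 
      @continuous_sigmaMk ι (fun i => InducedSpace (M i) (E i)) _ i⟩
  refine ⟨⟨fun a => (inc a.1).comp (H a.1 a.2), continuous_sigma fun i =>
    (ContinuousMap.continuous_postcomp (inc i)).comp (H i).continuous⟩,
    fun s => ⟨s.1, q s.1 s.2⟩, ?_, ?_, ?_, ?_⟩
  · rintro ⟨i, a⟩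
    exact congrArg (Sigma.mk i) (h0 i a)
  · rintro ⟨i, a⟩ t
    exact congrArg (Sigma.mk i) (h1 i a t)
  · rintro ⟨i, a⟩
    exact congrArg (Sigma.mk i) (h2 i a)
  · rintro ⟨i, s⟩
    exact congrArg (Sigma.mk i) (h3 i s)

/-- Collapsing contractible pieces of a subcomplex of a free contractible `G`-CW-complex to points
results in a contractible space. -/
theorem contractibleSpace_of_isGluing {G : Type u} [Group G] [TopologicalSpace G]
    [DiscreteTopology G] {A B Y X : Type u} [TopologicalSpace A] [MulAction G A]
    [TopologicalSpace B] [DiscreteTopology B] [TopologicalSpace Y] [MulAction G Y]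
    [ContinuousSMul G Y] [TopologicalSpace X] {u : C(A, B)} {j : C(A, Y)} {k : C(B, X)}
    {f : C(Y, X)} (glue : IsGluing u j k f) (hj : IsEmbedding j) (hjG : IsGMap G j)
    (c : GCWComplex G Y) (hfree : ∀ y : Y, MulAction.stabilizer G y = ⊥)
    (hA : c.IsSubcomplex (Set.range j)) [ContractibleSpace Y] (H : C(A, C(I, A))) (q : B → A)
    (h0 : ∀ a, H a 0 = a) (hu : ∀ a t, u (H a t) = u a) (h1 : ∀ a, H a 1 = q (u a))
    (hq : ∀ b, u (q b) = b) : ContractibleSpace X := by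
  have hinj := hj.injective
  let φ : Y → C(I, Y) := Function.extend j (fun a => j.comp (H a)) fun y => .const I y
  have hφj : ∀ a, φ (j a) = j.comp (H a) := fun a => hinj.extend_apply _ _ a
  have hφ : ContinuousOn φ (Set.range j) := by
    rw [continuousOn_iff_continuous_domRestrict]
    have e : Set.domRestrict (Set.range j) φ
        = (fun a => j.comp (H a)) ∘ hj.toHomeomorph.symm := by
      funext ⟨y, a, hy⟩
      subst hy
      refine (hφj a).trans (congrArg (fun a => j.comp (H a)) ?_)
      exact (hj.toHomeomorph.symm_apply_apply a).symm
    rw [e]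
    exact ((ContinuousMap.continuous_postcomp j).comp H.continuous).comp
      hj.toHomeomorph.symm.continuous
  obtain ⟨Φ, hΦ0, hΦA⟩ := c.exists_homotopy_extension hfree hA
    (by rintro g _ ⟨a, rfl⟩; exact ⟨g • a, hjG g a⟩) (ContinuousMap.id Y) φ hφ
    (by rintro _ ⟨a, rfl⟩; rw [hφj]; exact congrArg j (h0 a))
  have hΦj : ∀ a t, Φ (j a) t = j (H a t) := fun a t => by rw [hΦA _ ⟨a, rfl⟩, hφj]; rfl
  obtain ⟨K, hKk, hKf⟩ := glue.exists_desc (Z := C(I, X))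
    ⟨fun b => .const I (k b), continuous_of_discreteTopology⟩
    ⟨fun y => f.comp (Φ y), (ContinuousMap.continuous_postcomp f).comp Φ.continuous⟩ fun a => by
      ext t
      change k (u a) = f (Φ (j a) t)
      rw [hΦj, ← glue.comm, hu]
  obtain ⟨θ, hθk, hθf⟩ := glue.exists_desc (Z := Y)
    ⟨fun b => j (q b), continuous_of_discreteTopology⟩
    ⟨fun y => Φ y 1, (continuous_eval_const (1 : I)).comp Φ.continuous⟩ fun a => by
      change j (q (u a)) = Φ (j a) 1
      rw [hΦj, h1]
  have hK0 : ∀ x, K x 0 = x := fun x => by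
    rcases glue.cover x with ⟨b, rfl⟩ | ⟨y, -, rfl⟩
    · rw [hKk]
      rfl
    · rw [hKf]
      exact congrArg f (hΦ0 y)
  have hK1 : ∀ x, K x 1 = f (θ x) := fun x => by
    rcases glue.cover x with ⟨b, rfl⟩ | ⟨y, -, rfl⟩
    · rw [hKk, hθk]
      change k b = f (j (q b))
      rw [← glue.comm, hq]
    · rw [hKf, hθf]
      rfl
  have hom : ContinuousMap.Homotopic (ContinuousMap.id X) (f.comp θ) := ⟨{
    toFun := fun p => K p.2 p.1
    continuous_toFun := (ContinuousMap.uncurry K).continuous.comp continuous_swap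
    map_zero_left := hK0
    map_one_left := hK1 }⟩
  obtain ⟨y₀, hy₀⟩ := id_nullhomotopic Y
  rw [contractible_iff_id_nullhomotopic]
  refine ⟨f y₀, hom.trans ?_⟩
  exact ((ContinuousMap.Homotopic.refl f).comp hy₀).comp (ContinuousMap.Homotopic.refl θ)

/-! ### The cell structure of the pushout -/

namespace GCWComplex

section Collapse

variable {G : Type u} [Group G] [TopologicalSpace G] [DiscreteTopology G] {ι : Type u}
  {M : ι → Subgroup G} {A Y X : Type u} [TopologicalSpace A] [MulAction G A]
  [TopologicalSpace Y] [MulAction G Y] [ContinuousSMul G Y] [TopologicalSpace X] [MulAction G X]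
  [ContinuousSMul G X] {j : C(A, Y)} {u : C(A, Σ i, G ⧸ M i)} {f : C(Y, X)}
  {k : C((Σ i, G ⧸ M i), X)}

/-- The filtration of a space obtained from a `G`-CW-complex by collapsing a subcomplex to
orbits. -/
def collapseSkel (c : GCWComplex G Y) (hf : IsGMap G f) (hk : IsGMap G k) (n : ℕ) :
    SubMulAction G X where
  carrier := {x | (∃ y ∈ c.skel n, f y = x) ∨ (n ≠ 0 ∧ ∃ s, k s = x)}
  smul_mem' g x := by
    rintro (⟨y, hy, rfl⟩ | ⟨hn, s, rfl⟩)
    · exact Or.inl ⟨g • y, (c.skel n).smul_mem g hy, hf g y⟩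
    · exact Or.inr ⟨hn, g • s, hk g s⟩

/-- The characteristic maps of a space obtained from a `G`-CW-complex by collapsing a subcomplex to
orbits. -/
def collapseChar (c : GCWComplex G Y) (f : C(Y, X)) (k : C((Σ i, G ⧸ M i), X))
    (J : ∀ n, Set (c.cell n)) (n : ℕ) :
    C((Σ i : (ULift.{u} (PLift (n = 0)) × ι) ⊕ {i : c.cell n // i ∉ J n},
      OrbitProd (Sum.elim (fun x => M x.2) (fun x => c.isotropy n x.1) i) (CellDisk n)), X) where
  toFun
    | ⟨.inl x, o⟩ => k ⟨x.2, o.1⟩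
    | ⟨.inr x, o⟩ => f (c.charMap n ⟨x.1, o⟩)
  continuous_toFun := by
    refine continuous_sigma fun i => OrbitProd.continuous_iff.2 fun a => ?_
    rcases i with x | x
    · exact continuous_const (y := k ⟨x.2, a⟩)
    · have h := continuous_cells_iff.1 (c.charMap n).continuous x.1 a
      exact f.continuous.comp h

/-- Collapsing a subcomplex of a `G`-CW-complex to orbits yields a `G`-CW-complex. -/
theorem nonempty_of_isGPushout (c : GCWComplex G Y) (hj : IsEmbedding j)
    (hA : c.IsSubcomplex (Set.range j)) (hX : IsGPushout G j u f k) :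
    Nonempty (GCWComplex G X) := by
  have : ContinuousSMul G (Σ i, G ⧸ M i) := continuousSMul_of_discreteTopology
  have glue := hX.symm.isGluing hj.injective
  have hf := hX.right_equivariant
  have hk := hX.bottom_equivariant
  obtain ⟨hAc, J, hJ⟩ := hA
  have hjemb : IsClosedEmbedding j := ⟨hj, hAc⟩
  have notMem_range {n : ℕ} {i : c.cell n} {o} (hi : i ∉ J n)
      (h : c.charMap n ⟨i, o⟩ ∉ c.skel n) : c.charMap n ⟨i, o⟩ ∉ Set.range j :=
    fun h' => hi (c.mem_of_charMap_mem_subcomplex hJ h h')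
  have mem_range_of_eq {s y} (h : k s = f y) : y ∈ Set.range j := by
    obtain ⟨a, -, ha⟩ := glue.eq_imp s y h
    exact ⟨a, ha⟩
  have preimage_skel {S : Set X} {n : ℕ}
      (hS : IsClosed (S ∩ (collapseSkel c hf hk n : Set X))) :
      IsClosed (f ⁻¹' S ∩ c.skel n) := by
    have e : f ⁻¹' S ∩ c.skel n = f ⁻¹' (S ∩ (collapseSkel c hf hk n : Set X)) ∩ c.skel n := by
      ext y
      exact ⟨fun h => ⟨⟨h.1, Or.inl ⟨y, h.2, rfl⟩⟩, h.2⟩, fun h => ⟨h.1.1, h.2⟩⟩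
    rw [e]
    exact (hS.preimage f.continuous).inter (c.isClosed_skel n)
  refine ⟨ofCharMap (collapseSkel c hf hk) ?_ ?_ ?_ ?_ _ _ (collapseChar c f k J) ?_ ?_ ?_ ?_ ?_ ?_⟩
  · ext x
    refine ⟨?_, fun h => h.elim⟩
    rintro (⟨y, hy, -⟩ | ⟨h, -⟩)
    · rw [c.skel_zero] at hy
      exact hy.elim
    · exact absurd rfl h
  · rintro m n hmn x (⟨y, hy, rfl⟩ | ⟨h, hs⟩)
    · exact Or.inl ⟨y, c.skel_mono hmn hy, rfl⟩
    · exact Or.inr ⟨by omega, hs⟩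
  · intro x
    rcases glue.cover x with hs | ⟨y, -, rfl⟩
    · exact ⟨1, Or.inr ⟨one_ne_zero, hs⟩⟩
    · obtain ⟨n, hn⟩ := c.skel_exhaust y
      exact ⟨n, Or.inl ⟨y, hn, rfl⟩⟩
  · intro S hS
    exact glue.isClosed S (isClosed_discrete _)
      (c.isClosed_of_inter fun n => preimage_skel (hS n))
  · rintro n g ⟨x | x, o⟩
    · exact hk g ⟨x.2, o.1⟩
    · exact (congrArg f (c.charMap_smul n g ⟨x.1, o⟩)).trans (hf g _)
  · rintro n ⟨x | x, o⟩
    · exact Or.inr ⟨n.succ_ne_zero, _, rfl⟩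
    · exact Or.inl ⟨_, c.charMap_mem n ⟨x.1, o⟩, rfl⟩
  · rintro n ⟨⟨⟨⟨rfl⟩⟩, i⟩ | x, o⟩
    · constructor
      · rintro (⟨y, hy, -⟩ | ⟨h, -⟩)
        · rw [c.skel_zero] at hy
          exact hy.elim
        · exact absurd rfl h
      · rintro ⟨q, -⟩
        exact isEmptyElim q.2.2
    · rw [mem_range_cellsBoundaryInclusion]
      refine Iff.trans ?_ ((c.charMap_mem_iff (p := ⟨x.1, o⟩)).trans
        mem_range_cellsBoundaryInclusion)
      refine ⟨?_, fun h => Or.inl ⟨_, h, rfl⟩⟩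
      intro h
      by_contra h'
      have hr := notMem_range x.2 h'
      rcases h with ⟨y, hy, e⟩ | ⟨-, s, e⟩
      · rcases glue.eq_or_mem _ _ e with rfl | h
        · exact h' hy
        · exact hr h.2
      · exact hr (mem_range_of_eq e)
  · have notMem {n : ℕ} {x : {i : c.cell n // i ∉ J n}} {o}
        (h : f (c.charMap n ⟨x.1, o⟩) ∉ collapseSkel c hf hk n) :
        c.charMap n ⟨x.1, o⟩ ∉ c.skel n := fun h' => h (Or.inl ⟨_, h', rfl⟩)
    rintro n ⟨x | x, o⟩ ⟨x' | x', o'⟩ hp e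
    · obtain ⟨⟨⟨rfl⟩⟩, i⟩ := x
      obtain ⟨⟨⟨_⟩⟩, i'⟩ := x'
      obtain ⟨a, d⟩ := o
      obtain ⟨a', d'⟩ := o'
      have e := glue.injective e
      obtain rfl : i = i' := congrArg Sigma.fst e
      obtain rfl : a = a' := eq_of_heq (Sigma.mk.inj_iff.1 e).2
      obtain rfl : d = d' := Subtype.ext (Subsingleton.elim _ _)
      rfl
    · have h : f (c.charMap n ⟨x'.1, o'⟩) ∉ collapseSkel c hf hk n := fun h => hp (e ▸ h)
      exact absurd (mem_range_of_eq e) (notMem_range x'.2 (notMem h))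
    · exact absurd (mem_range_of_eq e.symm) (notMem_range x.2 (notMem hp))
    · rcases glue.eq_or_mem _ _ e with h | h
      · have e := c.charMap_inj (notMem hp) h
        obtain ⟨x, hx⟩ := x
        obtain ⟨x', hx'⟩ := x'
        obtain rfl : x = x' := congrArg Sigma.fst e
        obtain rfl : o = o' := eq_of_heq (Sigma.mk.inj_iff.1 e).2
        rfl
      · exact absurd h.1 (notMem_range x.2 (notMem hp))
  · have key (n : ℕ) (s) : k s ∈ collapseSkel c hf hk n ∨
        ∃ p, collapseChar c f k J n p = k s := by
      rcases eq_or_ne n 0 with rfl | hn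
      · exact Or.inr ⟨⟨.inl (⟨⟨rfl⟩⟩, s.1), OrbitProd.mk s.2 (CellDisk.center 0)⟩, rfl⟩
      · exact Or.inl (Or.inr ⟨hn, s, rfl⟩)
    rintro n _ (⟨y, hy, rfl⟩ | ⟨-, s, rfl⟩)
    · rcases c.mem_skel_or n hy with h | ⟨⟨i, o⟩, rfl⟩
      · exact Or.inl (Or.inl ⟨y, h, rfl⟩)
      · by_cases hi : i ∈ J n
        · obtain ⟨a, ha⟩ := c.charMap_mem_subcomplex hAc hJ hi o
          rw [← ha, ← glue.comm]
          exact key n _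
        · exact Or.inr ⟨⟨.inr ⟨i, hi⟩, o⟩, rfl⟩
    · exact key n s
  · intro n S h h'
    have closed_range : IsClosed (f ⁻¹' S ∩ Set.range j) := by
      have e : f ⁻¹' S ∩ Set.range j = j '' (u ⁻¹' (k ⁻¹' S)) := by
        rw [← Set.image_preimage_eq_inter_range, ← Set.preimage_comp, ← Set.preimage_comp,
          show f ∘ j = k ∘ u from funext fun a => (glue.comm a).symm]
      rw [e]
      exact hjemb.isClosedMap _ ((isClosed_discrete _).preimage u.continuous)
    have closed_skel : IsClosed (f ⁻¹' S ∩ c.skel (n + 1)) := by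
      refine c.isClosed_inter_succ (preimage_skel h) (isClosed_cells_iff.2 fun i a => ?_)
      by_cases hi : i ∈ J n
      · have e : {d | (⟨i, OrbitProd.mk a d⟩ : Σ i, OrbitProd (c.isotropy n i) (CellDisk n)) ∈
            c.charMap n ⁻¹' (f ⁻¹' S)} = (fun d => c.charMap n ⟨i, OrbitProd.mk a d⟩) ⁻¹'
            (f ⁻¹' S ∩ Set.range j) := by
          ext d
          exact ⟨fun hd => ⟨hd, c.charMap_mem_subcomplex hAc hJ hi _⟩, fun hd => hd.1⟩
        rw [e]
        exact closed_range.preimage (continuous_cells_iff.1 (c.charMap n).continuous i a)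
      · exact isClosed_cells_iff.1 h' (.inr ⟨i, hi⟩) a
    refine glue.isClosed _ (isClosed_discrete _) ?_
    convert closed_skel.union closed_range using 1
    ext y
    constructor
    · rintro ⟨hS, ⟨y', hy', e⟩ | ⟨-, s, e⟩⟩
      · rcases glue.eq_or_mem _ _ e with rfl | hr
        · exact Or.inl ⟨hS, hy'⟩
        · exact Or.inr ⟨hS, hr.2⟩
      · exact Or.inr ⟨hS, mem_range_of_eq e⟩
    · rintro (⟨hS, hy⟩ | ⟨hS, a, rfl⟩)
      · exact ⟨hS, Or.inl ⟨y, hy, rfl⟩⟩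
      · exact ⟨hS, Or.inr ⟨n.succ_ne_zero, u a, glue.comm a⟩⟩

end Collapse

end GCWComplex

/-! ### Maximal finite subgroups and fixed points -/

section MaximalFinite

variable {G : Type*} [Group G]

theorem mem_map_conj {M : Subgroup G} {g x : G} :
    x ∈ M.map (MulAut.conj g).toMonoidHom ↔ g⁻¹ * x * g ∈ M := by
  constructor
  · rintro ⟨m, hm, rfl⟩
    simpa [mul_assoc] using hm
  · intro h
    exact ⟨_, h, by simp [mul_assoc]⟩

theorem IsMaximalFinite.map_conj {M : Subgroup G} (hM : IsMaximalFinite M) (g : G) :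
    IsMaximalFinite (M.map (MulAut.conj g).toMonoidHom) := by
  have := hM.prop
  refine ⟨Finite.Set.finite_image (M : Set G) _, fun K hK h => ?_⟩
  have : Finite K := hK
  have hK' : Finite (K.comap (MulAut.conj g).toMonoidHom) :=
    ((Set.toFinite (K : Set G)).preimage (f := MulAut.conj g)
      (MulAut.conj g).injective.injOn).to_subtype
  rw [← Subgroup.map_comap_eq_self_of_surjective (f := (MulAut.conj g).toMonoidHom)
    (MulAut.conj g).surjective K]
  exact Subgroup.map_mono (hM.le_of_ge hK' (Subgroup.map_le_iff_le_comap.1 h))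

variable {ι : Type*} {M : ι → Subgroup G}

theorem stabilizer_sigma_quotient (i : ι) (g : G) :
    MulAction.stabilizer G (⟨i, (g : G ⧸ M i)⟩ : Σ i, G ⧸ M i)
      = (M i).map (MulAut.conj g).toMonoidHom := by
  ext x
  rw [mem_map_conj, MulAction.mem_stabilizer_iff, Sigma.smul_mk, Sigma.mk.inj_iff, heq_iff_eq,
    MulAction.Quotient.smul_mk, eq_comm (a := ((x • g : G) : G ⧸ M i)), QuotientGroup.eq,
    smul_eq_mul, mul_assoc]
  exact and_iff_right rfl

theorem isMaximalFinite_stabilizer (hmax : ∀ i, IsMaximalFinite (M i)) (s : Σ i, G ⧸ M i) :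
    IsMaximalFinite (MulAction.stabilizer G s) := by
  obtain ⟨i, g⟩ := s
  induction g using QuotientGroup.induction_on with
  | H g =>
    rw [stabilizer_sigma_quotient]
    exact (hmax i).map_conj g

theorem existsUnique_le_stabilizer (hM : ConditionM G) (hNM : ConditionNM G)
    (hmax : ∀ i, IsMaximalFinite (M i))
    (hrep : ∀ N : Subgroup G, IsMaximalFinite N →
      ∃! i, ∃ g : G, N = (M i).map (MulAut.conj g).toMonoidHom)
    {H : Subgroup G} (hH : Finite H) (hH' : H ≠ ⊥) :
    ∃! s : Σ i, G ⧸ M i, H ≤ MulAction.stabilizer G s := by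
  obtain ⟨N, ⟨hN, hHN⟩, hNu⟩ := hM H hH hH'
  obtain ⟨i, ⟨g, rfl⟩, hi⟩ := hrep N hN
  refine ⟨⟨i, g⟩, hHN.trans_eq (stabilizer_sigma_quotient i g).symm, ?_⟩
  rintro ⟨i', g'⟩ h
  induction g' using QuotientGroup.induction_on with
  | H g' =>
    have e := hNu _ ⟨isMaximalFinite_stabilizer hmax _, h⟩
    rw [stabilizer_sigma_quotient] at e
    obtain rfl : i' = i := hi i' ⟨g', e.symm⟩
    have hne : M i' ≠ ⊥ := by
      rintro h0
      rw [h0, Subgroup.map_bot] at hHN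
      exact hH' (le_bot_iff.1 hHN)
    have hmem : g'⁻¹ * g ∈ Subgroup.normalizer (M i' : Set G) := by
      rw [Subgroup.mem_normalizer_iff]
      intro x
      have := SetLike.ext_iff.1 e (g * x * g⁻¹)
      rw [mem_map_conj, mem_map_conj] at this
      have e1 : g⁻¹ * (g * x * g⁻¹) * g = x := by group
      have e2 : g'⁻¹ * (g * x * g⁻¹) * g' = g'⁻¹ * g * x * (g'⁻¹ * g)⁻¹ := by group
      rw [e1, e2] at this
      exact this.symm
    rw [hNM _ (hmax i') hne] at hmem
    rw [QuotientGroup.eq.2 hmem]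

end MaximalFinite

theorem mainTheorem5 {G : Type u} [Group G] [TopologicalSpace G] [DiscreteTopology G]
    (hM : ConditionM G) (hNM : ConditionNM G)
    {ι : Type u} (M : ι → Subgroup G)
    (hmax : ∀ i, IsMaximalFinite (M i))
    (hrep : ∀ N : Subgroup G, IsMaximalFinite N →
      ∃! i, ∃ g : G, N = (M i).map (MulAut.conj g).toMonoidHom)
    (E : ι → Type u) [∀ i, TopologicalSpace (E i)] [∀ i, MulAction (M i) (E i)]
    [∀ i, ContinuousSMul (M i) (E i)]
    (hE : ∀ i, IsModelEG (M i) (E i))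
    (EG : Type u) [TopologicalSpace EG] [MulAction G EG] [ContinuousSMul G EG]
    (hEG : IsModelEG G EG)
    (j : C((Σ i, InducedSpace (M i) (E i)), EG))
    (hj_equivariant : IsGMap G j) (hj_embedding : IsEmbedding j)
    (hj_subcomplex : ∃ c : GCWComplex G EG, c.IsSubcomplex (Set.range j))
    (X : Type u) [TopologicalSpace X] [MulAction G X] [ContinuousSMul G X]
    (f : C(EG, X)) (k : C((Σ i, G ⧸ M i), X))
    (hX : IsGPushout G j (collapseMaps M E) f k) :
    IsModelProperEG G X := by
  obtain ⟨c, hc⟩ := hj_subcomplex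
  have : ContinuousSMul G (Σ i, G ⧸ M i) := continuousSMul_of_discreteTopology
  have hfree : ∀ y : EG, MulAction.stabilizer G y = ⊥ := hEG.stabilizer_mem
  have : ContractibleSpace EG := hEG.contractibleSpace
  have : ∀ i, ContractibleSpace (E i) := fun i => (hE i).contractibleSpace
  have glue := hX.symm.isGluing hj_embedding.injective
  have hf := hX.right_equivariant
  have hk := hX.bottom_equivariant
  have stab_k (s) : MulAction.stabilizer G (k s) = MulAction.stabilizer G s := by
    ext g
    rw [MulAction.mem_stabilizer_iff, MulAction.mem_stabilizer_iff, ← hk,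
      glue.injective.eq_iff]
  have stab_f {y} (hy : y ∉ Set.range j) : MulAction.stabilizer G (f y) = ⊥ := by
    rw [eq_bot_iff, ← hfree y]
    intro g hg
    rw [MulAction.mem_stabilizer_iff, ← hf] at hg
    exact (glue.eq_or_mem _ _ hg).resolve_right fun h => hy h.2
  have contractible : ContractibleSpace X := by
    obtain ⟨H, q, h0, hu, h1, hq⟩ := exists_fiberwise_contraction_collapseMaps M E
    exact contractibleSpace_of_isGluing glue hj_embedding hj_equivariant c hfree hc H q h0 hu h1 hq
  refine ⟨c.nonempty_of_isGPushout hj_embedding hc hX, fun x => ?_, ?_⟩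
  · rcases glue.cover x with ⟨s, rfl⟩ | ⟨y, hy, rfl⟩
    · rw [stab_k]
      exact (isMaximalFinite_stabilizer hmax s).prop
    · rw [stab_f hy]
      exact (inferInstance : Finite (⊥ : Subgroup G))
  · rintro Y _ _ _ ⟨cY⟩ hY
    refine cY.exists_gMap_unique_upto_homotopy fun n i => ?_
    rw [← cY.stabilizer_center]
    have hfin : Finite (MulAction.stabilizer G (cY.center n i)) := hY (cY.center n i)
    generalize MulAction.stabilizer G (cY.center n i) = H at hfin
    rcases eq_or_ne H ⊥ with rfl | hne
    · have e : MulAction.fixedPoints (⊥ : Subgroup G) X = Set.univ :=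
        Set.eq_univ_of_forall fun x g => by
          rw [Subsingleton.elim g 1, one_smul]
      rw [e]
      exact (Homeomorph.Set.univ X).contractibleSpace
    · obtain ⟨s, hs, hsu⟩ := existsUnique_le_stabilizer hM hNM hmax hrep hfin hne
      have fixed (x : X) : x ∈ MulAction.fixedPoints H X ↔ H ≤ MulAction.stabilizer G x :=
        ⟨fun h g hg => h ⟨g, hg⟩, fun h g => h g.2⟩
      have e : MulAction.fixedPoints H X = {k s} := by
        ext x
        rw [fixed, Set.mem_singleton_iff]
        constructor
        · intro h
          rcases glue.cover x with ⟨s', rfl⟩ | ⟨y, hy, rfl⟩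
          · rw [stab_k] at h
            rw [hsu s' h]
          · rw [stab_f hy] at h
            exact absurd (le_bot_iff.1 h) hne
        · rintro rfl
          rwa [stab_k]
      rw [e]
      infer_instance
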